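/- Let $n\ge 1$ and let $\mathbb F_n^+$ be the free monoid on generators $g_1,\dots,g_n$ with identity $g_0$; write $|\alpha|$ for the length of a word, and $\lambda_\alpha=\lambda_{i_1}\cdots\lambda_{i_m}$ for $\lambda\in\mathbb C^n$, $\alpha=g_{i_1}\cdots g_{i_m}$ (with $\lambda_{g_0}=1$). Let $f=\sum_{|\alpha|\ge 1}a_\alpha X_\alpha$ be a positive regular free holomorphic function, i.e. $a_\alpha\ge 0$ for all $\alpha$, $a_{g_0}=0$, $a_{g_i}>0$ for $i=1,\dots,n$, and $\limsup_{k\to\infty}\big(\sum_{|\alpha|=k}|a_\alpha|^2\big)^{1/2k}<\infty$. Put $b_{g_0}=1$ and $$b_\alpha=\sum_{j=1}^{|\alpha|}\ \sum_{\gamma_1\cdots\gamma_j=\alpha,\ |\gamma_i|\ge 1}a_{\gamma_1}\cdots a_{\gamma_j}\qquad(|\alpha|\ge 1).$$ Let $F^2(H_n)$ be the full Fock space on $n$ generators, with its orthonormal basis $(e_\alpha)_{\alpha\in\mathbb F_n^+}$ and $1=e_{g_0}$, and let $W_1,\dots,W_n$ be the bounded operators on $F^2(H_n)$ with $W_ie_\alpha=\sqrt{b_\alpha/b_{g_i\alpha}}\;e_{g_i\alpha}$;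 write $W_\beta=W_{i_1}\cdots W_{i_m}$ for $\beta=g_{i_1}\cdots g_{i_m}$. The Hardy algebra $F_n^\infty(\mathcal D_f)$ consists of all bounded operators $A$ on $F^2(H_n)$ for which there are $c_\beta\in\mathbb C$ with $\sum_\beta|c_\beta|^2/b_\beta<\infty$ and $Ap=\sum_\beta c_\beta W_\beta p$ for every finite linear combination $p$ of the $e_\alpha$. Let $J_c$ be the $w^*$-closed two-sided ideal of $F_n^\infty(\mathcal D_f)$ generated by the commutators $W_iW_j-W_jW_i$, $i,j=1,\dots,n$, and $\mathcal N_{J_c}:=F^2(H_n)\ominus\overline{J_c(1)}$. Put $$\mathcal D_f^\circ(\mathbb C)=\Big\{\lambda\in\mathbb C^n:\ \sum_{|\alpha|\ge1}a_\alpha|\lambda_\alpha|^2<1\Big\},\qquad z_\lambda=\sum_{\beta}\sqrt{b_\beta}\,\overline{\lambda_\beta}\,e_\beta\quad(\lambda\in\mathcal D_f^\circ(\mathbb C)).$$ For $\mathbf k\in\mathbb N_0^n$ let $\lambda^{\mathbf k}=\lambda_1^{k_1}\cdots\lambda_n^{k_n}$, $\Lambda_{\mathbf k}=\{\alpha:\lambda_\alpha=\lambda^{\mathbf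 k}\text{ for all }\lambda\in\mathbb C^n\}$, $\gamma_{\mathbf k}=\sum_{\alpha\in\Lambda_{\mathbf k}}b_\alpha$ and $w^{\mathbf k}=\frac1{\gamma_{\mathbf k}}\sum_{\alpha\in\Lambda_{\mathbf k}}\sqrt{b_\alpha}\,e_\alpha$. The symmetric weighted Fock space $F_s^2(\mathcal D_f)$ is the closed linear span of the vectors $w^{\mathbf k}$. Inner products are linear in the first variable. Then: (i) $F_s^2(\mathcal D_f)=\overline{\operatorname{span}}\{z_\lambda:\lambda\in\mathcal D_f^\circ(\mathbb C)\}=\mathcal N_{J_c}$. (ii) Every $\varphi\in F_s^2(\mathcal D_f)$ has a unique expansion $\varphi=\sum_{\mathbf k}c_{\mathbf k}w^{\mathbf k}$; moreover $\|\varphi\|^2=\sum_{\mathbf k}|c_{\mathbf k}|^2/\gamma_{\mathbf k}$ and, for all $\lambda\in\mathcal D_f^\circ(\mathbb C)$, $$\varphi(\lambda):=\langle\varphi,z_\lambda\rangle=\sum_{\mathbf k}c_{\mathbf k}\lambda^{\mathbf k},\qquad |\varphi(\lambda)|\le\frac{\|\varphi\|}{\sqrt{1-\sum_{|\alpha|\ge1}a_\alpha|\lambda_\alpha|^2}}.$$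 Let $H^2(\mathcal D_f^\circ(\mathbb C))$ be the space of all functions $\varphi:\mathcal D_f^\circ(\mathbb C)\to\mathbb C$ which admit a power series representation $\varphi(\lambda)=\sum_{\mathbf k}c_{\mathbf k}\lambda^{\mathbf k}$ on $\mathcal D_f^\circ(\mathbb C)$ with $\sum_{\mathbf k}|c_{\mathbf k}|^2/\gamma_{\mathbf k}<\infty$. Then $H^2(\mathcal D_f^\circ(\mathbb C))$ is a Hilbert space with the (well-defined) norm $\|\varphi\|_2^2=\sum_{\mathbf k}|c_{\mathbf k}|^2/\gamma_{\mathbf k}$, and $\varphi\mapsto\big(\lambda\mapsto\langle\varphi,z_\lambda\rangle\big)$ is a unitary operator from $F_s^2(\mathcal D_f)$ onto $H^2(\mathcal D_f^\circ(\mathbb C))$. (iii) For all $\lambda,\mu\in\mathcal D_f^\circ(\mathbb C)$ the series $\sum_{|\alpha|\ge1}a_\alpha\mu_\alpha\overline{\lambda_\alpha}$ converges absolutely, its sum is not $1$, and $$K_f(\mu,\lambda):=\langle z_\lambda,z_\mu\rangle=\frac1{1-\sum_{|\alpha|\ge1}a_\alpha\mu_\alpha\overline{\lambda_\alpha}}.$$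 The kernel $K_f$ is (strictly) positive definite on $\mathcal D_f^\circ(\mathbb C)$: $\sum_{i,j}\overline{x_i}x_jK_f(\lambda^{(i)},\lambda^{(j)})>0$ for any finitely many distinct points $\lambda^{(i)}\in\mathcal D_f^\circ(\mathbb C)$ and complex numbers $x_i$, not all zero. Moreover $H^2(\mathcal D_f^\circ(\mathbb C))$ is a reproducing kernel Hilbert space with reproducing kernel $K_f$. -/

import Mathlib

open scoped ENNReal ComplexConjugate ComplexOrder Topology

noncomputable section

/-- The full Fock space `F²(H_n) = ⨁ H_n^{⊗k}`, written in the orthonormal basis `e_α` of elementary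
tensors `e_{i₁} ⊗ ⋯ ⊗ e_{i_k}`, `α = g_{i₁} ⋯ g_{i_k}` in the free monoid on `n` generators. -/
abbrev Fock (n : ℕ) : Type := lp (fun _ : FreeMonoid (Fin n) => ℂ) 2

open Classical in
/-- The basis vector `e_α`; `e_1` is the vacuum vector `1`. -/
def Fock.e {n : ℕ} (α : FreeMonoid (Fin n)) : Fock n := lp.single 2 α (1 : ℂ)

/-- The polynomials in `F²(H_n)`: finite linear combinations of the `e_α`. -/
def Fock.polynomials (n : ℕ) : Submodule ℂ (Fock n) := Submodule.span ℂ (Set.range Fock.e)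

/-- `λ_α = λ_{i₁} ⋯ λ_{i_m}` for `α = g_{i₁} ⋯ g_{i_m}`, and `λ_1 = 1`. -/
def evalWord {n : ℕ} (l : Fin n → ℂ) (α : FreeMonoid (Fin n)) : ℂ := FreeMonoid.lift l α

/-- `λ^k = λ_1^{k_1} ⋯ λ_n^{k_n}`. -/
def evalMulti {n : ℕ} (l : Fin n → ℂ) (k : Fin n → ℕ) : ℂ := ∏ i, l i ^ k i

/-- The w*-topology on `B(H)` (as the dual of the trace class), i.e. the coarsest topology making
all functionals `T ↦ ∑ ⟨T x_k, y_k⟩` with `∑ ‖x_k‖² < ∞`, `∑ ‖y_k‖² < ∞` continuous. -/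
@[reducible] def weakStarTopology (H : Type*) [NormedAddCommGroup H] [InnerProductSpace ℂ H] :
    TopologicalSpace (H →L[ℂ] H) :=
  ⨅ (x : ℕ → H) (y : ℕ → H) (_ : Summable fun k => ‖x k‖ ^ 2) (_ : Summable fun k => ‖y k‖ ^ 2),
    TopologicalSpace.induced (fun T : H →L[ℂ] H => ∑' k, inner ℂ (y k) (T (x k))) inferInstance

theorem finite_factorizations {n : ℕ} (α : FreeMonoid (Fin n)) :
    {L : List (FreeMonoid (Fin n)) | L.prod = α ∧ ∀ w ∈ L, w ≠ 1}.Finite := by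
  induction h : α.length using Nat.strong_induction_on generalizing α with
  | _ m ih =>
    have hp : {p : FreeMonoid (Fin n) × FreeMonoid (Fin n) | p.1 * p.2 = α ∧ p.1 ≠ 1}.Finite := by
      refine ((Set.finite_Iic α.length).image (fun k =>
        (FreeMonoid.ofList (α.toList.take k), FreeMonoid.ofList (α.toList.drop k)))).subset ?_
      rintro ⟨u, v⟩ ⟨rfl, -⟩
      refine ⟨u.length, by simp [FreeMonoid.length_mul], ?_⟩
      simp [FreeMonoid.toList_mul, FreeMonoid.length]
    refine ((Set.finite_singleton []).union (hp.biUnion (t := fun p => (fun L => p.1 :: L) ''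
      {L : List (FreeMonoid (Fin n)) | L.prod = p.2 ∧ ∀ w ∈ L, w ≠ 1}) ?_)).subset ?_
    · rintro ⟨u, v⟩ ⟨rfl, hu⟩
      refine Set.Finite.image _ (ih v.length ?_ v rfl)
      rw [← h, FreeMonoid.length_mul]
      have : u.length ≠ 0 := fun h0 => hu (FreeMonoid.length_eq_zero.1 h0)
      lia
    · rintro (_ | ⟨w, L⟩) ⟨hL, hw⟩
      · simp
      · right
        simp only [Set.mem_iUnion]
        exact ⟨(w, L.prod), ⟨by simpa using hL, hw w (by simp)⟩, L,
          ⟨rfl, fun v hv => hw v (by simp [hv])⟩, rfl⟩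

/-- All `(γ_1, …, γ_j)`, `j ≥ 0`, with `γ_1 ⋯ γ_j = α` and `|γ_i| ≥ 1` for every `i`. -/
def factorizations {n : ℕ} (α : FreeMonoid (Fin n)) : Finset (List (FreeMonoid (Fin n))) :=
  (finite_factorizations α).toFinset

theorem mem_factorizations {n : ℕ} {α : FreeMonoid (Fin n)} {L : List (FreeMonoid (Fin n))} :
    L ∈ factorizations α ↔ L.prod = α ∧ ∀ w ∈ L, w ≠ 1 := by
  simp [factorizations]

theorem finite_wordsOfType {n : ℕ} (k : Fin n → ℕ) :
    {α : FreeMonoid (Fin n) | ∀ l : Fin n → ℂ, evalWord l α = evalMulti l k}.Finite := by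
  refine (List.finite_length_eq (Fin n) (∑ i, k i)).subset fun (α : FreeMonoid (Fin n)) hα => ?_
  have h := hα fun _ => 2
  unfold evalWord evalMulti at h
  rw [FreeMonoid.lift_apply, List.map_const', List.prod_replicate,
    Finset.prod_pow_eq_pow_sum] at h
  have h2 : (2 : ℕ) ^ (FreeMonoid.toList α).length = 2 ^ ∑ i, k i := by exact_mod_cast h
  exact Nat.pow_right_injective le_rfl h2

/-- `Λ_k = {α : λ_α = λ^k for all λ ∈ ℂⁿ}`. -/
def wordsOfType {n : ℕ} (k : Fin n → ℕ) : Finset (FreeMonoid (Fin n)) :=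
  (finite_wordsOfType k).toFinset

/-- A positive regular free holomorphic function `f = ∑_{|α| ≥ 1} a_α X_α` in `n` noncommuting
variables, given by its coefficients `a_α`; the last condition says that the radius of convergence
is positive: `limsup_k (∑_{|α| = k} |a_α|²)^{1/2k} < ∞`. -/
structure PositiveRegular (n : ℕ) where
  a : FreeMonoid (Fin n) → ℝ
  a_nonneg : ∀ α, 0 ≤ a α
  a_one : a 1 = 0
  a_of_pos : ∀ i, 0 < a (FreeMonoid.of i)
  limsup_lt_top : Filter.limsup (fun k : ℕ =>
    (∑' α : {α : FreeMonoid (Fin n) // α.length = k}, ‖a α‖ₑ ^ 2) ^ (1 / (2 * k : ℝ)))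
      Filter.atTop < ⊤

namespace PositiveRegular

/-- `b_α = ∑_{j} ∑_{γ_1 ⋯ γ_j = α, |γ_i| ≥ 1} a_{γ_1} ⋯ a_{γ_j}`; in particular `b_1 = 1`. -/
def b {n : ℕ} (f : PositiveRegular n) (α : FreeMonoid (Fin n)) : ℝ :=
  ∑ L ∈ factorizations α, (L.map f.a).prod

/-- The domain `𝒟_f°(ℂ) = {λ ∈ ℂⁿ : ∑_{|α| ≥ 1} a_α |λ_α|² < 1}` (recall `a_1 = 0`). -/
def domain {n : ℕ} (f : PositiveRegular n) : Set (Fin n → ℂ) :=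
  {l | (Summable fun α => f.a α * ‖evalWord l α‖ ^ 2) ∧ ∑' α, f.a α * ‖evalWord l α‖ ^ 2 < 1}

theorem prod_nonneg {n : ℕ} (f : PositiveRegular n) (L : List (FreeMonoid (Fin n))) :
    0 ≤ (L.map f.a).prod :=
  List.prod_nonneg (by simpa using fun w _ => f.a_nonneg w)

theorem b_nonneg {n : ℕ} (f : PositiveRegular n) (α : FreeMonoid (Fin n)) : 0 ≤ f.b α :=
  Finset.sum_nonneg fun L _ => f.prod_nonneg L

theorem b_mul_le {n : ℕ} (f : PositiveRegular n) (i : Fin n) (α : FreeMonoid (Fin n)) :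
    f.a (FreeMonoid.of i) * f.b α ≤ f.b (FreeMonoid.of i * α) := by
  classical
  have hinj : Function.Injective fun L : List (FreeMonoid (Fin n)) => FreeMonoid.of i :: L :=
    List.cons_injective
  calc f.a (FreeMonoid.of i) * f.b α
      = ∑ L ∈ (factorizations α).map ⟨_, hinj⟩, (L.map f.a).prod := by
        simp [b, Finset.mul_sum]
    _ ≤ f.b (FreeMonoid.of i * α) := by
        refine Finset.sum_le_sum_of_subset_of_nonneg ?_ fun L _ _ => f.prod_nonneg L
        intro L hL
        obtain ⟨M, hM, rfl⟩ := Finset.mem_map.1 hL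
        rw [mem_factorizations] at hM ⊢
        simpa [hM.1] using hM.2

theorem summable_b {n : ℕ} (f : PositiveRegular n) {l : Fin n → ℂ} (hl : l ∈ f.domain) :
    Summable fun β => f.b β * ‖evalWord l β‖ ^ 2 := by
  set g : FreeMonoid (Fin n) → ℝ≥0∞ := fun w => ENNReal.ofReal (f.a w * ‖evalWord l w‖ ^ 2) with hg
  have hs : ∑' w, g w < 1 := by
    rw [hg, ← ENNReal.ofReal_tsum_of_nonneg
      (fun w => mul_nonneg (f.a_nonneg w) (sq_nonneg _)) hl.1]
    simpa using hl.2
  have hlen : ∀ j : ℕ, ∑' L : (List.length ⁻¹' {j} : Set (List (FreeMonoid (Fin n)))), (L.1.map g).prod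
      = (∑' w, g w) ^ j := by
    intro j
    induction j with
    | zero =>
      have : (List.length ⁻¹' {0} : Set (List (FreeMonoid (Fin n)))) = {[]} := by
        ext L; simp
      rw [this, tsum_singleton [] fun L : List (FreeMonoid (Fin n)) => (L.map g).prod]; simp
    | succ j ih =>
      let e : FreeMonoid (Fin n) × (List.length ⁻¹' {j} : Set (List (FreeMonoid (Fin n)))) ≃
          (List.length ⁻¹' {j + 1} : Set (List (FreeMonoid (Fin n)))) :=
        Equiv.ofBijective (fun p => ⟨p.1 :: p.2.1, congrArg Nat.succ p.2.2⟩) (by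
          constructor
          · rintro ⟨u, L, hL⟩ ⟨v, M, hM⟩ h
            obtain ⟨rfl, rfl⟩ := List.cons.inj (congrArg Subtype.val h)
            rfl
          · rintro ⟨_ | ⟨u, L⟩, hL⟩
            · simp at hL
            · exact ⟨(u, ⟨L, Nat.succ.inj hL⟩), rfl⟩)
      rw [← e.tsum_eq, ENNReal.tsum_prod']
      change ∑' (u : FreeMonoid (Fin n)) (L : (List.length ⁻¹' {j} : Set (List _))),
        ((u :: L.1).map g).prod = _
      simp_rw [List.map_cons, List.prod_cons, ENNReal.tsum_mul_left, ih]
      rw [ENNReal.tsum_mul_right, pow_succ']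
  have htot : ∑' L : List (FreeMonoid (Fin n)), (L.map g).prod < ⊤ := by
    rw [← ENNReal.tsum_fiberwise _ List.length]
    simp_rw [hlen]
    rw [ENNReal.tsum_geometric]
    exact ENNReal.inv_lt_top.2 (tsub_pos_of_lt hs)
  have hprod : ∀ L : List (FreeMonoid (Fin n)),
      (L.map g).prod = ENNReal.ofReal ((L.map f.a).prod * ‖evalWord l L.prod‖ ^ 2) := by
    intro L
    induction L with
    | nil => simp [evalWord]
    | cons w L ih =>
      rw [List.map_cons, List.prod_cons, ih, List.map_cons, List.prod_cons, List.prod_cons]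
      simp only [hg]
      rw [← ENNReal.ofReal_mul (mul_nonneg (f.a_nonneg w) (sq_nonneg _))]
      congr 1
      simp only [evalWord, map_mul, norm_mul]
      ring
  have hle : ∑' β, ENNReal.ofReal (f.b β * ‖evalWord l β‖ ^ 2) < ⊤ := by
    refine lt_of_le_of_lt ?_ htot
    rw [← ENNReal.tsum_fiberwise _ List.prod]
    refine ENNReal.tsum_le_tsum fun β => ?_
    have hset : (↑(factorizations β) : Set (List (FreeMonoid (Fin n)))) ⊆ List.prod ⁻¹' {β} :=
      fun L hL => (mem_factorizations.1 hL).1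
    calc ENNReal.ofReal (f.b β * ‖evalWord l β‖ ^ 2)
        = ∑ L ∈ factorizations β, (L.map g).prod := by
          rw [b, Finset.sum_mul, ENNReal.ofReal_sum_of_nonneg
            fun L _ => mul_nonneg (f.prod_nonneg L) (sq_nonneg _)]
          refine Finset.sum_congr rfl fun L hL => ?_
          rw [hprod, (mem_factorizations.1 hL).1]
      _ = ∑' L : (↑(factorizations β) : Set (List (FreeMonoid (Fin n)))), (L.1.map g).prod :=
          ((factorizations β).tsum_subtype' fun L => (L.map g).prod).symm
      _ ≤ _ := ENNReal.tsum_mono_subtype (fun L => (L.map g).prod) hset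
  have := ENNReal.summable_toReal hle.ne
  refine this.congr fun β => ?_
  exact ENNReal.toReal_ofReal (mul_nonneg (f.b_nonneg β) (sq_nonneg _))

/-- `z_λ = ∑_β √(b_β) conj(λ_β) e_β ∈ F²(H_n)`, for `λ ∈ 𝒟_f°(ℂ)`. -/
def z {n : ℕ} (f : PositiveRegular n) (l : f.domain) : Fock n :=
  ⟨fun β => (√(f.b β) : ℂ) * conj (evalWord l.1 β), by
    refine memℓp_gen ((f.summable_b l.2).congr fun β => ?_)
    simp [mul_pow, Real.sq_sqrt (f.b_nonneg β)]⟩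

/-- Coefficients of `W_i φ`: the coefficient at `g_i α` is `√(b_α / b_{g_i α}) φ_α`, and the
coefficients at words not beginning with `g_i` vanish. -/
def shiftFun {n : ℕ} (f : PositiveRegular n) (i : Fin n) (φ : FreeMonoid (Fin n) → ℂ) :
    FreeMonoid (Fin n) → ℂ :=
  Function.extend (fun α => FreeMonoid.of i * α)
    (fun α => (√(f.b α / f.b (FreeMonoid.of i * α)) : ℂ) * φ α) 0

theorem of_mul_injective {n : ℕ} (i : Fin n) :
    Function.Injective fun α : FreeMonoid (Fin n) => FreeMonoid.of i * α :=
  fun _ _ h => mul_left_cancel h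

theorem shiftFun_hasSum {n : ℕ} (f : PositiveRegular n) (i : Fin n) (φ : Fock n) :
    Summable (fun β => ‖f.shiftFun i φ β‖ ^ 2) ∧
      ∑' β, ‖f.shiftFun i φ β‖ ^ 2 ≤ (f.a (FreeMonoid.of i))⁻¹ * ‖φ‖ ^ 2 := by
  have hφ : HasSum (fun α => ‖φ α‖ ^ 2) (‖φ‖ ^ 2) := by
    simpa using lp.hasSum_norm (p := 2) (by norm_num) φ
  have hle : ∀ α, ‖(√(f.b α / f.b (FreeMonoid.of i * α)) : ℂ) * φ α‖ ^ 2 ≤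
      (f.a (FreeMonoid.of i))⁻¹ * ‖φ α‖ ^ 2 := by
    intro α
    have hi := f.a_of_pos i
    rw [norm_mul, mul_pow, Complex.norm_real, Real.norm_eq_abs, sq_abs,
      Real.sq_sqrt (div_nonneg (f.b_nonneg _) (f.b_nonneg _))]
    gcongr
    refine div_le_of_le_mul₀ (f.b_nonneg _) (inv_nonneg.2 hi.le) ?_
    rw [inv_mul_eq_div, le_div_iff₀ hi, mul_comm]
    exact f.b_mul_le i α
  have hsum := Summable.of_nonneg_of_le (fun α => sq_nonneg _) hle (hφ.summable.mul_left _)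
  have hext : (fun β => ‖f.shiftFun i φ β‖ ^ 2) = Function.extend
      (fun α => FreeMonoid.of i * α)
      (fun α => ‖(√(f.b α / f.b (FreeMonoid.of i * α)) : ℂ) * φ α‖ ^ 2) 0 := by
    funext β
    by_cases h : ∃ α, FreeMonoid.of i * α = β
    · obtain ⟨α, rfl⟩ := h
      rw [shiftFun, (of_mul_injective i).extend_apply, (of_mul_injective i).extend_apply]
    · rw [shiftFun, Function.extend_apply' _ _ _ h, Function.extend_apply' _ _ _ h]
      simp
  have hs := (hasSum_extend_zero (of_mul_injective i)).2 hsum.hasSum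
  rw [← hext] at hs
  refine ⟨hs.summable, ?_⟩
  rw [hs.tsum_eq, ← (hφ.mul_left _).tsum_eq]
  exact hsum.tsum_le_tsum hle (hφ.summable.mul_left _)

/-- The weighted left creation operators `W_1, …, W_n` associated with `𝒟_f`. -/
def W {n : ℕ} (f : PositiveRegular n) (i : Fin n) : Fock n →L[ℂ] Fock n :=
  LinearMap.mkContinuous
    { toFun := fun φ => ⟨f.shiftFun i φ, memℓp_gen (by simpa using (f.shiftFun_hasSum i φ).1)⟩
      map_add' := fun φ ψ => by
        ext β
        by_cases h : ∃ α, FreeMonoid.of i * α = β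
        · obtain ⟨α, rfl⟩ := h
          change f.shiftFun i _ _ = f.shiftFun i _ _ + f.shiftFun i _ _
          simp [shiftFun, (of_mul_injective i).extend_apply, mul_add]
        · change f.shiftFun i _ _ = f.shiftFun i _ _ + f.shiftFun i _ _
          simp [shiftFun, Function.extend_apply' _ _ _ h]
      map_smul' := fun c φ => by
        ext β
        by_cases h : ∃ α, FreeMonoid.of i * α = β
        · obtain ⟨α, rfl⟩ := h
          simp [shiftFun, (of_mul_injective i).extend_apply, mul_left_comm]
        · simp [shiftFun, Function.extend_apply' _ _ _ h] }
    (√(f.a (FreeMonoid.of i))⁻¹) fun φ => by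
      have hi := f.a_of_pos i
      refine (sq_le_sq₀ (norm_nonneg _) (by positivity)).1 ?_
      rw [mul_pow, Real.sq_sqrt (inv_nonneg.2 hi.le)]
      refine le_of_eq_of_le ?_ (f.shiftFun_hasSum i φ).2
      simpa using (lp.hasSum_norm (p := 2) (by norm_num)
        (⟨f.shiftFun i φ, memℓp_gen (by simpa using (f.shiftFun_hasSum i φ).1)⟩ :
          Fock n)).tsum_eq.symm

/-- `W_i e_α = √(b_α / b_{g_i α}) e_{g_i α}`. -/
theorem W_e {n : ℕ} (f : PositiveRegular n) (i : Fin n) (α : FreeMonoid (Fin n)) :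
    f.W i (Fock.e α) =
      (√(f.b α / f.b (FreeMonoid.of i * α)) : ℂ) • Fock.e (FreeMonoid.of i * α) := by
  ext β
  rw [lp.coeFn_smul, Pi.smul_apply]
  change f.shiftFun i (Fock.e α) β = _
  by_cases h : ∃ γ, FreeMonoid.of i * γ = β
  · obtain ⟨γ, rfl⟩ := h
    rw [shiftFun, (of_mul_injective i).extend_apply]
    rcases eq_or_ne γ α with rfl | hγ
    · simp [Fock.e]
    · have : FreeMonoid.of i * γ ≠ FreeMonoid.of i * α := fun h => hγ (mul_left_cancel h)
      simp [Fock.e, hγ, this]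
  · have : β ≠ FreeMonoid.of i * α := fun h' => h ⟨α, h'.symm⟩
    rw [shiftFun, Function.extend_apply' _ _ _ h]
    simp [Fock.e, this]

/-- `W_β = W_{i_1} ⋯ W_{i_m}` for `β = g_{i_1} ⋯ g_{i_m}`, and `W_1 = I`. -/
def wordW {n : ℕ} (f : PositiveRegular n) (β : FreeMonoid (Fin n)) : Fock n →L[ℂ] Fock n :=
  FreeMonoid.lift f.W β

/-- The Hardy algebra `F_n^∞(𝒟_f)`: all bounded operators `A` on `F²(H_n)` for which there are
coefficients `c_β` with `∑ |c_β|² / b_β < ∞` and `A p = ∑_β c_β W_β p` for every polynomial `p`. -/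
def hardy {n : ℕ} (f : PositiveRegular n) : Set (Fock n →L[ℂ] Fock n) :=
  {A | ∃ c : FreeMonoid (Fin n) → ℂ, (Summable fun β => ‖c β‖ ^ 2 / f.b β) ∧
    ∀ p ∈ Fock.polynomials n, HasSum (fun β => c β • f.wordW β p) (A p)}

/-- `J` is a w*-closed two-sided ideal of the Hardy algebra `F_n^∞(𝒟_f)`. -/
structure IsWeakStarClosedIdeal {n : ℕ} (f : PositiveRegular n)
    (J : Submodule ℂ (Fock n →L[ℂ] Fock n)) : Prop where
  subset_hardy : ∀ B ∈ J, B ∈ f.hardy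
  mul_mem_left : ∀ A ∈ f.hardy, ∀ B ∈ J, A * B ∈ J
  mul_mem_right : ∀ A ∈ f.hardy, ∀ B ∈ J, B * A ∈ J
  isClosed : IsClosed[weakStarTopology (Fock n)] (J : Set (Fock n →L[ℂ] Fock n))

/-- `J_c`: the w*-closed two-sided ideal of `F_n^∞(𝒟_f)` generated by the commutators
`W_i W_j - W_j W_i`. -/
def commIdeal {n : ℕ} (f : PositiveRegular n) : Submodule ℂ (Fock n →L[ℂ] Fock n) :=
  sInf {J | f.IsWeakStarClosedIdeal J ∧ ∀ i j, f.W i * f.W j - f.W j * f.W i ∈ J}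

/-- `𝒩_{J_c} = F²(H_n) ⊖ closure of J_c(1)`. -/
def commN {n : ℕ} (f : PositiveRegular n) : Submodule ℂ (Fock n) :=
  ((f.commIdeal.map (ContinuousLinearMap.apply ℂ (Fock n)
    (Fock.e 1 : Fock n)).toLinearMap).topologicalClosure)ᗮ

/-- `γ_k = ∑_{α ∈ Λ_k} b_α`. -/
def γ {n : ℕ} (f : PositiveRegular n) (k : Fin n → ℕ) : ℝ := ∑ α ∈ wordsOfType k, f.b α

/-- `w^k = (1/γ_k) ∑_{α ∈ Λ_k} √(b_α) e_α`. -/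
def w {n : ℕ} (f : PositiveRegular n) (k : Fin n → ℕ) : Fock n :=
  ((1 / f.γ k : ℝ) : ℂ) • ∑ α ∈ wordsOfType k, (√(f.b α) : ℂ) • Fock.e α

/-- The symmetric weighted Fock space `F_s²(𝒟_f)`: the closed span of the vectors `w^k`. -/
def symFock {n : ℕ} (f : PositiveRegular n) : Submodule ℂ (Fock n) :=
  (Submodule.span ℂ (Set.range f.w)).topologicalClosure

/-- `φ(λ) = ∑_k c_k λ^k` for every `λ ∈ 𝒟_f°(ℂ)`. -/
def IsPowerSeries {n : ℕ} (f : PositiveRegular n) (φ : f.domain → ℂ) (c : (Fin n → ℕ) → ℂ) : Prop :=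
  ∀ l : f.domain, HasSum (fun k => c k * evalMulti l.1 k) (φ l)

theorem summable_add_sq {ι : Type*} {g : ι → ℝ} (hg : ∀ k, 0 ≤ g k) {c d : ι → ℂ}
    (hc : Summable fun k => ‖c k‖ ^ 2 * (1 / g k)) (hd : Summable fun k => ‖d k‖ ^ 2 * (1 / g k)) :
    Summable fun k => ‖c k + d k‖ ^ 2 * (1 / g k) := by
  refine Summable.of_nonneg_of_le (fun k => mul_nonneg (sq_nonneg _) (one_div_nonneg.2 (hg k)))
    (fun k => ?_) ((hc.add hd).mul_left 2)
  have h1 : ‖c k + d k‖ ^ 2 ≤ 2 * (‖c k‖ ^ 2 + ‖d k‖ ^ 2) := by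
    have := norm_add_le (c k) (d k)
    nlinarith [sq_nonneg (‖c k‖ - ‖d k‖), norm_nonneg (c k + d k)]
  calc _ ≤ 2 * (‖c k‖ ^ 2 + ‖d k‖ ^ 2) * (1 / g k) :=
        mul_le_mul_of_nonneg_right h1 (one_div_nonneg.2 (hg k))
    _ = _ := by ring

theorem γ_nonneg {n : ℕ} (f : PositiveRegular n) (k : Fin n → ℕ) : 0 ≤ f.γ k :=
  Finset.sum_nonneg fun α _ => f.b_nonneg α

/-- The vector space of all functions on `𝒟_f°(ℂ)` with a power series representation
`∑_k c_k λ^k` such that `∑_k |c_k|² / γ_k < ∞`. -/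
def H2Submodule {n : ℕ} (f : PositiveRegular n) : Submodule ℂ (f.domain → ℂ) where
  carrier := {φ | ∃ c, f.IsPowerSeries φ c ∧ Summable fun k => ‖c k‖ ^ 2 * (1 / f.γ k)}
  zero_mem' := ⟨0, fun l => by simp, by simp⟩
  add_mem' := by
    rintro φ ψ ⟨c, hc, hc'⟩ ⟨d, hd, hd'⟩
    exact ⟨c + d, fun l => by simpa [add_mul] using (hc l).add (hd l),
      summable_add_sq f.γ_nonneg hc' hd'⟩
  smul_mem' := by
    rintro x φ ⟨c, hc, hc'⟩
    exact ⟨x • c, fun l => by simpa [mul_assoc] using (hc l).mul_left x,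
      by simpa [mul_pow, mul_assoc] using hc'.mul_left (‖x‖ ^ 2)⟩

/-- `H²(𝒟_f°(ℂ))` as a complex vector space of functions (no topology is inherited from the
ambient space of all functions). -/
def H2 {n : ℕ} (f : PositiveRegular n) : Type := f.H2Submodule

instance {n : ℕ} (f : PositiveRegular n) : AddCommGroup f.H2 :=
  inferInstanceAs (AddCommGroup f.H2Submodule)

instance {n : ℕ} (f : PositiveRegular n) : Module ℂ f.H2 :=
  inferInstanceAs (Module ℂ f.H2Submodule)

/-- The function underlying an element of `H²(𝒟_f°(ℂ))`. -/
def H2.toFun {n : ℕ} {f : PositiveRegular n} (φ : f.H2) : f.domain → ℂ := Subtype.val φ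

/-- `K_f(μ, λ) = ⟨z_λ, z_μ⟩`, where `⟨·, ·⟩` is linear in the first variable; Mathlib's `inner` is
linear in the second one. -/
def K {n : ℕ} (f : PositiveRegular n) (m l : f.domain) : ℂ := inner ℂ (f.z m) (f.z l)

end PositiveRegular

end

/-! Everything is read off coordinates in the basis `e_α`. Call a vector symmetric if its coordinate
at `α`, divided by `√b_α`, depends only on the letter counts of `α`. Grouping the basis expansion by
letter counts shows that the symmetric vectors are exactly the sums `∑ c_k w^k`. The `w^k` are
orthogonal with `‖w^k‖² = 1/γ_k` and `⟨w^k, z_λ⟩ = λ^k`, so norms and values follow termwise.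

The growth condition on `a` makes the domain a neighbourhood of `0`. A power series vanishing there
has zero coefficients, so no nonzero symmetric vector is orthogonal to every `z_λ`. This gives
density of the `z_λ`, uniqueness of coefficients, and the identification with `H²`, whose inner
product is transported.

For the commutator ideal, `mem_hardy_iff` identifies the Hardy algebra with the commutant of the
weighted right creation operators. Its elements whose symbols vanish on the domain form a w*-closed
ideal containing the commutators, so every `z_λ` lies in `𝒩_{J_c}`. Conversely, orthogonality to
`W_p (W_i W_j - W_j W_i) W_s 1` permits swapping adjacent letters, which forces symmetry.

The kernel is a geometric series: summing over all lists of words gives `(∑ b_β x_β)(1 - ∑ a_α x_α)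
= 1`. Strict positivity is the linear independence of distinct characters of the free monoid. -/

noncomputable section

/-! ### Letter counts of words and positivity of the weights. -/

/-- The number of occurrences of each generator in a word. -/
def wordType {n : ℕ} (α : FreeMonoid (Fin n)) : Fin n → ℕ := fun i => α.toList.count i

theorem evalWord_eq_evalMulti {n : ℕ} (l : Fin n → ℂ) (α : FreeMonoid (Fin n)) :
    evalWord l α = evalMulti l (wordType α) := by
  rw [evalWord, FreeMonoid.lift_apply, Finset.prod_list_map_count, evalMulti]
  refine Finset.prod_subset (Finset.subset_univ _) fun i _ hi => ?_
  rw [List.count_eq_zero_of_not_mem (by simpa using hi), pow_zero]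

theorem mem_wordsOfType {n : ℕ} {α : FreeMonoid (Fin n)} {k : Fin n → ℕ} :
    α ∈ wordsOfType k ↔ wordType α = k := by
  simp only [wordsOfType, Set.Finite.mem_toFinset, Set.mem_ofPred_eq, evalWord_eq_evalMulti]
  refine ⟨fun h => funext fun i => ?_, fun h l => by rw [h]⟩
  -- The point with `2` in place `i` and `1` elsewhere isolates the `i`-th exponent as a power of
  -- `2`.
  have h1 := h (Function.update 1 i 2)
  simp only [evalMulti] at h1
  rw [Finset.prod_eq_single i, Finset.prod_eq_single i] at h1
  · simp only [Function.update_self] at h1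
    exact Nat.pow_right_injective le_rfl (by exact_mod_cast h1)
  all_goals simp +contextual [Function.update_of_ne]

theorem wordType_surjective {n : ℕ} : Function.Surjective (wordType (n := n)) := by
  intro k
  refine ⟨FreeMonoid.ofList (∑ i, k i • ({i} : Multiset (Fin n))).toList, funext fun i => ?_⟩
  simp only [wordType, FreeMonoid.toList_ofList]
  rw [← Multiset.coe_count, Multiset.coe_toList, Multiset.count_sum']
  simp [Multiset.count_singleton]

namespace PositiveRegular

variable {n : ℕ} (f : PositiveRegular n)

theorem b_one : f.b 1 = 1 := by
  have : factorizations (1 : FreeMonoid (Fin n)) = {[]} := by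
    ext L
    rw [mem_factorizations, Finset.mem_singleton]
    refine ⟨fun h => ?_, by rintro rfl; simp⟩
    rcases L with _ | ⟨w, L⟩
    · rfl
    · refine absurd ?_ (h.2 w (by simp))
      have h1 := congrArg FreeMonoid.length h.1
      rw [List.prod_cons, FreeMonoid.length_mul, FreeMonoid.length_one] at h1
      exact FreeMonoid.length_eq_zero.1 (by lia)
  simp [b, this]

theorem b_pos (α : FreeMonoid (Fin n)) : 0 < f.b α := by
  induction α using FreeMonoid.inductionOn' with
  | one => simp [b_one]
  | of_mul i α ih => exact (mul_pos (f.a_of_pos i) ih).trans_le (f.b_mul_le i α)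

theorem sqrt_b_pos (α : FreeMonoid (Fin n)) : 0 < √(f.b α) := Real.sqrt_pos.2 (f.b_pos α)

theorem sqrt_b_ne_zero (α : FreeMonoid (Fin n)) : (√(f.b α) : ℂ) ≠ 0 :=
  Complex.ofReal_ne_zero.2 (f.sqrt_b_pos α).ne'

theorem sqrt_b_mul_self (α : FreeMonoid (Fin n)) : (√(f.b α) : ℂ) * √(f.b α) = f.b α := by
  rw [← Complex.ofReal_mul, Real.mul_self_sqrt (f.b_nonneg α)]

theorem γ_pos (k : Fin n → ℕ) : 0 < f.γ k := by
  obtain ⟨α, hα⟩ := wordType_surjective k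
  exact Finset.sum_pos (fun α _ => f.b_pos α) ⟨α, mem_wordsOfType.2 hα⟩

theorem γ_ne_zero (k : Fin n → ℕ) : (f.γ k : ℂ) ≠ 0 :=
  Complex.ofReal_ne_zero.2 (f.γ_pos k).ne'

end PositiveRegular

/-! ### Coordinates in the Fock space. -/

theorem Fock.e_apply {n : ℕ} (α β : FreeMonoid (Fin n)) [Decidable (β = α)] :
    (Fock.e α : Fock n) β = if β = α then 1 else 0 := by
  classical
  simp only [Fock.e, lp.coeFn_single, Pi.single_apply]
  congr

theorem Fock.inner_e_left {n : ℕ} (α : FreeMonoid (Fin n)) (φ : Fock n) :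
    inner ℂ (Fock.e α) φ = φ α := by
  classical
  rw [Fock.e, lp.inner_single_left]; simp

theorem Fock.inner_e_right {n : ℕ} (α : FreeMonoid (Fin n)) (φ : Fock n) :
    inner ℂ φ (Fock.e α) = conj (φ α) := by
  rw [← inner_conj_symm, Fock.inner_e_left]

theorem Fock.hasSum_e {n : ℕ} (φ : Fock n) : HasSum (fun α => φ α • Fock.e α) φ := by
  classical
  convert! lp.hasSum_single (p := 2) (by norm_num) φ using 2 with α
  rw [Fock.e, ← lp.single_smul]; simp

theorem Fock.clm_ext {n : ℕ} {E : Type*} [NormedAddCommGroup E] [NormedSpace ℂ E]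
    {S T : Fock n →L[ℂ] E} (h : ∀ α, S (Fock.e α) = T (Fock.e α)) : S = T := by
  ext φ
  have h1 := (Fock.hasSum_e φ).mapL S
  have h2 := (Fock.hasSum_e φ).mapL T
  simp only [map_smul, h] at h1 h2
  exact h1.unique h2

namespace PositiveRegular

variable {n : ℕ} (f : PositiveRegular n)

/-! ### Orthogonal expansions in the vectors `w^k`. -/

theorem inner_w_left (k : Fin n → ℕ) (φ : Fock n) :
    inner ℂ (f.w k) φ = (1 / f.γ k : ℂ) * ∑ α ∈ wordsOfType k, (√(f.b α) : ℂ) * φ α := by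
  simp [w, Fock.inner_e_left, mul_comm]

theorem w_apply (k : Fin n → ℕ) (α : FreeMonoid (Fin n)) :
    (f.w k : Fock n) α = if wordType α = k then (√(f.b α) : ℂ) / f.γ k else 0 := by
  classical
  rw [← Fock.inner_e_left, w, inner_smul_right, inner_sum]
  simp only [inner_smul_right, Fock.inner_e_left, Fock.e_apply]
  simp [mem_wordsOfType]
  split_ifs <;> ring

theorem inner_w_w [DecidableEq (Fin n → ℕ)] (j k : Fin n → ℕ) :
    inner ℂ (f.w j) (f.w k) = if j = k then (1 / f.γ k : ℂ) else 0 := by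
  rw [inner_w_left]
  split_ifs with h
  · subst h
    have : ∀ α ∈ wordsOfType j, (√(f.b α) : ℂ) * f.w j α = f.b α / f.γ j := fun α hα => by
      rw [w_apply, if_pos (mem_wordsOfType.1 hα), ← mul_div_assoc, f.sqrt_b_mul_self]
    rw [Finset.sum_congr rfl this, ← Finset.sum_div, ← Complex.ofReal_sum]
    change (1 / f.γ j : ℂ) * (f.γ j / f.γ j) = _
    rw [div_self (f.γ_ne_zero j), mul_one]
  · rw [Finset.sum_eq_zero, mul_zero]
    intro α hα
    rw [w_apply, if_neg (by rw [mem_wordsOfType.1 hα]; exact h), mul_zero]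

/-- On words of type `k` the vector `z_λ` is the constant `conj(λ^k)` times `√b_α`; the resulting
sum `γ_k` cancels the normalisation of `w^k`. -/
theorem inner_z_w (l : f.domain) (k : Fin n → ℕ) : inner ℂ (f.z l) (f.w k) = evalMulti l.1 k := by
  rw [← inner_conj_symm, inner_w_left]
  have : ∀ α ∈ wordsOfType k, (√(f.b α) : ℂ) * f.z l α = f.b α * conj (evalMulti l.1 k) :=
    fun α hα => by
      rw [← f.sqrt_b_mul_self, ← mem_wordsOfType.1 hα, ← evalWord_eq_evalMulti, mul_assoc]; rfl
  rw [Finset.sum_congr rfl this, ← Finset.sum_mul, ← Complex.ofReal_sum]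
  change conj ((1 / f.γ k : ℂ) * (f.γ k * _)) = _
  rw [one_div, inv_mul_cancel_left₀ (f.γ_ne_zero k), Complex.conj_conj]

theorem inner_w_of_hasSum {c : (Fin n → ℕ) → ℂ} {φ : Fock n}
    (h : HasSum (fun k => c k • f.w k) φ) (k : Fin n → ℕ) :
    inner ℂ (f.w k) φ = c k / f.γ k := by
  classical
  have h1 := h.mapL (innerSL ℂ (f.w k))
  simp only [innerSL_apply_apply, inner_smul_right, inner_w_w] at h1
  refine h1.unique ?_
  convert! hasSum_ite_eq k (c k / f.γ k : ℂ) using 2 with j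
  by_cases hj : j = k
  · simp [hj, div_eq_mul_inv]
  · simp [hj, Ne.symm hj]

theorem coeff_unique {c d : (Fin n → ℕ) → ℂ} {φ : Fock n}
    (hc : HasSum (fun k => c k • f.w k) φ) (hd : HasSum (fun k => d k • f.w k) φ) : c = d := by
  funext k
  have := (f.inner_w_of_hasSum hc k).symm.trans (f.inner_w_of_hasSum hd k)
  exact (div_left_inj' (f.γ_ne_zero k)).1 this

theorem hasSum_norm_sq {c : (Fin n → ℕ) → ℂ} {φ : Fock n}
    (h : HasSum (fun k => c k • f.w k) φ) :
    HasSum (fun k => ‖c k‖ ^ 2 * (1 / f.γ k)) (‖φ‖ ^ 2) := by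
  have h1 := h.mapL (innerSL ℂ φ)
  have h2 : ∀ k, inner ℂ φ (c k • f.w k) = ((‖c k‖ ^ 2 * (1 / f.γ k) : ℝ) : ℂ) := fun k => by
    rw [inner_smul_right, ← inner_conj_symm, f.inner_w_of_hasSum h]
    push_cast
    rw [← Complex.mul_conj']
    simp; ring
  simp only [innerSL_apply_apply, h2] at h1
  rw [inner_self_eq_norm_sq_to_K] at h1
  exact Complex.hasSum_ofReal.1 (by simpa using h1)

theorem hasSum_inner_z {c : (Fin n → ℕ) → ℂ} {φ : Fock n}
    (h : HasSum (fun k => c k • f.w k) φ) (l : f.domain) :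
    HasSum (fun k => c k * evalMulti l.1 k) (inner ℂ (f.z l) φ) := by
  have h1 := h.mapL (innerSL ℂ (f.z l))
  simpa only [innerSL_apply_apply, inner_smul_right, inner_z_w] using h1

theorem mem_symFock_of_hasSum {c : (Fin n → ℕ) → ℂ} {φ : Fock n}
    (h : HasSum (fun k => c k • f.w k) φ) : φ ∈ f.symFock := by
  refine (Submodule.isClosed_topologicalClosure _).mem_of_tendsto h
    (Filter.Eventually.of_forall fun s => Submodule.sum_mem _ fun k _ => ?_)
  exact Submodule.smul_mem _ _ (Submodule.le_topologicalClosure _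
    (Submodule.subset_span (Set.mem_range_self k)))

/-! ### Symmetric vectors. -/

/-- The coefficients of `φ`, up to the factors `√(b_α)`, depend only on the type of the word. -/
def IsSymmetric (φ : Fock n) : Prop :=
  ∀ α β, wordType α = wordType β → (√(f.b β) : ℂ) * φ α = √(f.b α) * φ β

/-- Each symmetry relation is the vanishing of a continuous linear functional, so it passes from the
`w^k` to their closed span. -/
theorem isSymmetric_of_mem {φ : Fock n} (h : φ ∈ f.symFock) : f.IsSymmetric φ := by
  intro α β hαβ
  have hc : ∀ α : FreeMonoid (Fin n), Continuous fun φ : Fock n => φ α := fun α => by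
    simp only [← Fock.inner_e_left]; fun_prop
  have hle : f.symFock ≤ LinearMap.ker ((√(f.b β) : ℂ) • innerSL ℂ (Fock.e α : Fock n) -
      (√(f.b α) : ℂ) • innerSL ℂ (Fock.e β : Fock n)).toLinearMap := by
    refine Submodule.topologicalClosure_minimal _ ?_ (ContinuousLinearMap.isClosed_ker _)
    rw [Submodule.span_le]
    rintro _ ⟨k, rfl⟩
    simp [Fock.inner_e_left, w_apply, hαβ]
    split_ifs <;> ring
  simpa [Fock.inner_e_left, sub_eq_zero] using hle h

/-- The basis expansion of `φ` is summed over the finite sets of words of equal type; `s k` is an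
arbitrary representative of type `k`, from which the coefficient is read. -/
theorem IsSymmetric.hasSum {f : PositiveRegular n} {φ : Fock n} (h : f.IsSymmetric φ) :
    ∃ c : (Fin n → ℕ) → ℂ, HasSum (fun k => c k • f.w k) φ := by
  choose s hs using wordType_surjective (n := n)
  refine ⟨fun k => f.γ k * φ (s k) / √(f.b (s k)), ?_⟩
  convert! (Fock.hasSum_e φ).tsum_fiberwise wordType using 2 with k
  have hset : (wordType ⁻¹' {k} : Set (FreeMonoid (Fin n))) = ↑(wordsOfType k) := by
    ext α; simp [mem_wordsOfType]
  rw [hset, Finset.tsum_subtype' (wordsOfType k) (fun α => φ α • Fock.e α), w, smul_smul,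
    Finset.smul_sum]
  refine Finset.sum_congr rfl fun α hα => ?_
  rw [smul_smul]
  congr 1
  have h1 := h α (s k) ((mem_wordsOfType.1 hα).trans (hs k).symm)
  have := f.sqrt_b_ne_zero (s k)
  have := f.γ_ne_zero k
  push_cast
  field_simp
  linear_combination -h1

theorem mem_symFock_iff {φ : Fock n} : φ ∈ f.symFock ↔ f.IsSymmetric φ :=
  ⟨f.isSymmetric_of_mem, fun h => f.mem_symFock_of_hasSum h.hasSum.choose_spec⟩

/-- Riesz–Fischer for the orthonormal family `√γ_k w^k`. -/
theorem exists_hasSum_w {c : (Fin n → ℕ) → ℂ}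
    (hc : Summable fun k => ‖c k‖ ^ 2 * (1 / f.γ k)) :
    ∃ φ : Fock n, HasSum (fun k => c k • f.w k) φ := by
  classical
  have hv : Orthonormal ℂ fun k => (√(f.γ k) : ℂ) • f.w k := by
    rw [orthonormal_iff_ite]
    intro j k
    rw [inner_smul_left, inner_smul_right, inner_w_w]
    split_ifs with h
    · subst h
      rw [Complex.conj_ofReal, ← mul_assoc, ← Complex.ofReal_mul,
        Real.mul_self_sqrt (f.γ_nonneg j), mul_one_div_cancel (f.γ_ne_zero j)]
    · simp
  have h1 := (hv.orthogonalFamily.summable_iff_norm_sq_summable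
    fun k => c k / √(f.γ k)).2 (hc.congr fun k => by
      rw [norm_div, Complex.norm_real, Real.norm_eq_abs, div_pow, sq_abs,
        Real.sq_sqrt (f.γ_nonneg k), mul_one_div])
  refine ⟨_, (h1.congr fun k => ?_).hasSum⟩
  have : (√(f.γ k) : ℂ) ≠ 0 := Complex.ofReal_ne_zero.2 (Real.sqrt_pos.2 (f.γ_pos k)).ne'
  rw [LinearIsometry.toSpanSingleton_apply, smul_smul, div_mul_cancel₀ _ this]

/-! ### The kernel as a geometric series over lists of words. -/

/-- Allowing empty words in factorizations makes the fibre infinite, but each list containing `1`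
contributes zero because `a_1 = 0`. -/
theorem hasSum_prod_fiber (β : FreeMonoid (Fin n)) :
    HasSum (fun L : (List.prod ⁻¹' {β} : Set (List (FreeMonoid (Fin n)))) => (L.1.map f.a).prod)
      (f.b β) := by
  change HasSum ((fun L : List (FreeMonoid (Fin n)) => (L.map f.a).prod) ∘ Subtype.val) _
  rw [hasSum_subtype_iff_indicator]
  have : f.b β = ∑ L ∈ factorizations β,
      (List.prod ⁻¹' {β} : Set (List (FreeMonoid (Fin n)))).indicator
        (fun L => (L.map f.a).prod) L :=
    Finset.sum_congr rfl fun L hL =>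
      (Set.indicator_of_mem (s := List.prod ⁻¹' {β}) (mem_factorizations.1 hL).1
        fun L => (L.map f.a).prod).symm
  rw [this]
  refine hasSum_sum_of_ne_finset_zero fun L hL => ?_
  by_cases hp : L.prod = β
  · have : 1 ∈ L := by
      by_contra h1
      exact hL (mem_factorizations.2 ⟨hp, fun w hw hw1 => h1 (hw1 ▸ hw)⟩)
    rw [Set.indicator_of_mem (s := List.prod ⁻¹' {β}) hp]
    exact List.prod_eq_zero (List.mem_map.2 ⟨1, this, f.a_one⟩)
  · exact Set.indicator_of_notMem (s := List.prod ⁻¹' {β}) hp _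

theorem evalWord_mul_conj (m l : Fin n → ℂ) (α : FreeMonoid (Fin n)) :
    evalWord (fun i => m i * conj (l i)) α = evalWord m α * conj (evalWord l α) := by
  simp only [evalWord_eq_evalMulti, evalMulti, mul_pow, Finset.prod_mul_distrib, map_prod, map_pow]

theorem list_prod_mul_evalWord (x : Fin n → ℂ) (L : List (FreeMonoid (Fin n))) :
    (L.map fun w => (f.a w : ℂ) * evalWord x w).prod =
      ((L.map f.a).prod : ℝ) * evalWord x L.prod := by
  induction L with
  | nil => simp [evalWord]
  | cons w L ih => 
    simp only [List.map_cons, List.prod_cons, ih]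
    simp only [evalWord, map_mul]
    push_cast
    ring

theorem hasSum_mul_of_summable_norm {ι κ : Type*} {g : ι → ℂ} {h : κ → ℂ}
    (hg : Summable fun i => ‖g i‖) (hh : Summable fun j => ‖h j‖) :
    HasSum (fun p : ι × κ => g p.1 * h p.2) ((∑' i, g i) * ∑' j, h j) :=
  hg.of_norm.hasSum.mul hh.of_norm.hasSum (summable_mul_of_summable_norm hg hh)

/-- A list is empty or a head followed by a list, so the total satisfies `S = g S + 1`. Only
absolute convergence is used, so that `1 - ∑ g ≠ 0` is a consequence rather than an assumption. -/
theorem tsum_list_prod_mul {ι : Type*} {g : ι → ℂ} (hg : Summable fun i => ‖g i‖)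
    (hP : Summable fun L : List ι => ‖(L.map g).prod‖) :
    (∑' L : List ι, (L.map g).prod) * (1 - ∑' i, g i) = 1 := by
  classical
  have hS := hP.of_norm.hasSum
  have h2 := hasSum_mul_of_summable_norm hg hP
  have hinj : Function.Injective fun p : ι × List ι => p.1 :: p.2 :=
    fun p q h => Prod.ext (List.cons.inj h).1 (List.cons.inj h).2
  have h3 : HasSum (fun L : List ι => if L = [] then 0 else (L.map g).prod)
      ((∑' i, g i) * ∑' L : List ι, (L.map g).prod) := by
    have h0 : ∀ L ∉ Set.range fun p : ι × List ι => p.1 :: p.2,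
        (if L = [] then 0 else (L.map g).prod) = 0 := by
      rintro (_ | ⟨w, L⟩) hL
      · exact if_pos rfl
      · exact absurd ⟨(w, L), rfl⟩ hL
    rw [← hinj.hasSum_iff h0]
    refine h2.congr_fun fun p => ?_
    simp only [Function.comp_apply, reduceCtorEq, if_false, List.map_cons, List.prod_cons]
  have h5 : (∑' L : List ι, (L.map g).prod) =
      (∑' i, g i) * (∑' L : List ι, (L.map g).prod) + 1 := by
    refine hS.unique ((h3.add (hasSum_ite_eq ([] : List ι) (1 : ℂ))).congr_fun fun L => ?_)
    rcases L with _ | ⟨w, L⟩ <;> simp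
  generalize (∑' L : List ι, (L.map g).prod) = S at h5 ⊢
  linear_combination h5

theorem hasSum_list_fiber (x : Fin n → ℂ) (β : FreeMonoid (Fin n)) :
    HasSum (fun L : (List.prod ⁻¹' {β} : Set (List (FreeMonoid (Fin n)))) =>
      (L.1.map fun w => (f.a w : ℂ) * evalWord x w).prod) (f.b β * evalWord x β) := by
  refine ((Complex.hasSum_ofReal.2 (f.hasSum_prod_fiber β)).mul_right _).congr_fun ?_
  rintro ⟨L, rfl⟩
  exact f.list_prod_mul_evalWord x L

theorem hasSum_norm_list_fiber (x : Fin n → ℂ) (β : FreeMonoid (Fin n)) :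
    HasSum (fun L : (List.prod ⁻¹' {β} : Set (List (FreeMonoid (Fin n)))) =>
      ‖(L.1.map fun w => (f.a w : ℂ) * evalWord x w).prod‖) ‖(f.b β : ℂ) * evalWord x β‖ := by
  rw [norm_mul, Complex.norm_real, Real.norm_of_nonneg (f.b_nonneg β)]
  refine ((f.hasSum_prod_fiber β).mul_right _).congr_fun ?_
  rintro ⟨L, rfl⟩
  rw [f.list_prod_mul_evalWord x L, norm_mul, Complex.norm_real,
    Real.norm_of_nonneg (f.prod_nonneg L)]

/-- `(∑ b_β x_β) (1 - ∑ a_α x_α) = 1`. -/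
theorem tsum_b_mul_one_sub {x : Fin n → ℂ}
    (ha : Summable fun α => ‖(f.a α : ℂ) * evalWord x α‖)
    (hb : Summable fun β => ‖(f.b β : ℂ) * evalWord x β‖) :
    (∑' β, (f.b β : ℂ) * evalWord x β) * (1 - ∑' α, (f.a α : ℂ) * evalWord x α) = 1 := by
  have hP : Summable fun L : List (FreeMonoid (Fin n)) =>
      ‖(L.map fun w => (f.a w : ℂ) * evalWord x w).prod‖ := by
    refine (Equiv.sigmaFiberEquiv List.prod).summable_iff.1
      ((summable_sigma_of_nonneg fun _ => norm_nonneg _).2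
        ⟨fun β => (f.hasSum_norm_list_fiber x β).summable, ?_⟩)
    exact hb.congr fun β => (f.hasSum_norm_list_fiber x β).tsum_eq.symm
  have h1 : ∑' β, (f.b β : ℂ) * evalWord x β =
      ∑' L : List (FreeMonoid (Fin n)), (L.map fun w => (f.a w : ℂ) * evalWord x w).prod := by
    rw [← (hP.of_norm.hasSum.tsum_fiberwise List.prod).tsum_eq]
    exact tsum_congr fun β => (f.hasSum_list_fiber x β).tsum_eq.symm
  rw [h1]
  exact tsum_list_prod_mul ha hP

theorem norm_mul_conj_le (u v : ℂ) : ‖u * conj v‖ ≤ (‖u‖ ^ 2 + ‖v‖ ^ 2) / 2 := by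
  rw [norm_mul, Complex.norm_conj]
  nlinarith [sq_nonneg (‖u‖ - ‖v‖)]

/-- The inequality `|u v̄| ≤ (|u|² + |v|²)/2` reduces convergence at the mixed point `m_i conj(l_i)`
to convergence at `m` and at `l`. -/
theorem summable_weighted {c : FreeMonoid (Fin n) → ℝ} (hc : ∀ α, 0 ≤ c α) {m l : Fin n → ℂ}
    (hm : Summable fun α => c α * ‖evalWord m α‖ ^ 2)
    (hl : Summable fun α => c α * ‖evalWord l α‖ ^ 2) :
    Summable fun α => ‖(c α : ℂ) * evalWord (fun i => m i * conj (l i)) α‖ := by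
  refine Summable.of_nonneg_of_le (fun _ => norm_nonneg _) (fun α => ?_) ((hm.add hl).div_const 2)
  rw [evalWord_mul_conj, norm_mul, Complex.norm_real, Real.norm_of_nonneg (hc α)]
  have := mul_le_mul_of_nonneg_left (norm_mul_conj_le (evalWord m α) (evalWord l α)) (hc α)
  linarith

theorem K_eq_tsum (m l : f.domain) :
    f.K m l = ∑' β, (f.b β : ℂ) * evalWord (fun i => m.1 i * conj (l.1 i)) β := by
  rw [K, lp.inner_eq_tsum]
  refine tsum_congr fun β => ?_
  rw [evalWord_mul_conj, ← f.sqrt_b_mul_self]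
  simp [z]
  ring

theorem K_mul_one_sub (m l : f.domain) :
    f.K m l * (1 - ∑' α, f.a α * evalWord m.1 α * conj (evalWord l.1 α)) = 1 := by
  rw [K_eq_tsum]
  simp only [mul_assoc]
  simp only [← evalWord_mul_conj]
  exact f.tsum_b_mul_one_sub (summable_weighted f.a_nonneg m.2.1 l.2.1)
    (summable_weighted f.b_nonneg (f.summable_b m.2) (f.summable_b l.2))

theorem summable_a_mul (m l : f.domain) :
    Summable fun α => f.a α * evalWord m.1 α * conj (evalWord l.1 α) := by
  simp only [mul_assoc]
  simp only [← evalWord_mul_conj]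
  exact (summable_weighted f.a_nonneg m.2.1 l.2.1).of_norm

theorem one_sub_tsum_ne_zero (m l : f.domain) :
    1 - ∑' α, f.a α * evalWord m.1 α * conj (evalWord l.1 α) ≠ 0 :=
  right_ne_zero_of_mul_eq_one (f.K_mul_one_sub m l)

theorem K_eq (m l : f.domain) :
    f.K m l = 1 / (1 - ∑' α, f.a α * evalWord m.1 α * conj (evalWord l.1 α)) :=
  eq_one_div_of_mul_eq_one_left (f.K_mul_one_sub m l)

theorem norm_z_sq (l : f.domain) :
    ‖f.z l‖ ^ 2 = 1 / (1 - ∑' α, f.a α * ‖evalWord l.1 α‖ ^ 2) := by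
  have h : f.K l l = _ := f.K_eq l l
  simp only [mul_assoc, Complex.mul_conj'] at h
  rw [K, inner_self_eq_norm_sq_to_K] at h
  have h2 : (∑' α, f.a α * (‖evalWord l.1 α‖ : ℂ) ^ 2) =
      ((∑' α, f.a α * ‖evalWord l.1 α‖ ^ 2 : ℝ) : ℂ) := by push_cast; rfl
  rw [h2] at h
  apply Complex.ofReal_injective
  rw [Complex.ofReal_pow, Complex.ofReal_div, Complex.ofReal_sub, Complex.ofReal_one]
  exact h

theorem norm_inner_z_le (l : f.domain) (φ : Fock n) :
    ‖(inner ℂ (f.z l) φ : ℂ)‖ ≤ ‖φ‖ / √(1 - ∑' α, f.a α * ‖evalWord l.1 α‖ ^ 2) := by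
  refine (norm_inner_le_norm _ _).trans_eq ?_
  rw [← Real.sqrt_sq (norm_nonneg (f.z l)), norm_z_sq, Real.sqrt_div' _ (sub_nonneg.2 l.2.2.le),
    Real.sqrt_one]
  ring

/-! ### Strict positivity of the kernel. -/

/-- Up to the nonzero factors `√b_α`, the coordinates of `z_λ` form the character of the free monoid
sending `g_i` to `conj λ_i`. Distinct points give distinct characters, and Dedekind's theorem
applies. -/
theorem linearIndependent_z : LinearIndependent ℂ f.z := by
  have h1 : LinearIndependent ℂ fun l : f.domain => (FreeMonoid.lift (fun i => conj (l.1 i)) :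
      FreeMonoid (Fin n) → ℂ) :=
    (linearIndependent_monoidHom (FreeMonoid (Fin n)) ℂ).comp
      (fun l : f.domain => FreeMonoid.lift fun i => conj (l.1 i)) fun l m h => by
        refine Subtype.ext (funext fun i => ?_)
        have := DFunLike.congr_fun h (FreeMonoid.of i)
        exact (starRingEnd ℂ).injective (by simpa using this)
  rw [linearIndependent_iff'] at h1 ⊢
  intro s g hg
  refine h1 s g (funext fun α => ?_)
  have h2 := congrArg (fun φ : Fock n => φ α) hg
  simp only [← Fock.inner_e_left, inner_sum, inner_smul_right, inner_zero_right] at h2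
  simp only [Fock.inner_e_left] at h2
  have h3 : ∀ l : f.domain, (f.z l : Fock n) α =
      √(f.b α) * FreeMonoid.lift (fun i => conj (l.1 i)) α := fun l => by
    change (√(f.b α) : ℂ) * conj (evalWord l.1 α) = √(f.b α) * evalWord (fun i => conj (l.1 i)) α
    simp [evalWord_eq_evalMulti, evalMulti]
  simp only [h3, mul_left_comm _ (√(f.b α) : ℂ), ← Finset.mul_sum] at h2
  simpa using (mul_eq_zero.1 h2).resolve_left (f.sqrt_b_ne_zero α)

theorem posDef_K : (Matrix.of f.K).PosDef := by
  refine ⟨Matrix.IsHermitian.ext fun m l => by simp [K], fun x hx => ?_⟩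
  -- The quadratic form of the kernel is the squared norm of `∑ x_i z_i`.
  have h : (x.sum fun i xi => x.sum fun j xj => star xi * Matrix.of f.K i j * xj) =
      ((‖x.sum fun i xi => xi • f.z i‖ ^ 2 : ℝ) : ℂ) := by
    have h1 := inner_self_eq_norm_sq_to_K (𝕜 := ℂ) (x.sum fun i xi => xi • f.z i)
    rw [Complex.ofReal_pow]
    refine Eq.trans ?_ h1
    simp only [Finsupp.sum, sum_inner, inner_sum, inner_smul_left, inner_smul_right, K,
      Matrix.of_apply]
    rw [Finset.sum_comm]
    refine Finset.sum_congr rfl fun i _ => ?_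
    rw [Finset.mul_sum]
    refine Finset.sum_congr rfl fun j _ => ?_
    rw [starRingEnd_apply]
    ring
  rw [h]
  have h0 : (x.sum fun i xi => xi • f.z i) ≠ 0 := fun h0 =>
    hx (linearIndependent_iff.1 f.linearIndependent_z x h0)
  exact_mod_cast pow_pos (norm_pos_iff.2 h0) 2

end PositiveRegular

/-! ### Interior of the domain and uniqueness of power series. -/

theorem ENNReal.tsum_list_prod {n : ℕ} (g : Fin n → ℝ≥0∞) :
    ∑' L : List (Fin n), (L.map g).prod = (1 - ∑ i, g i)⁻¹ := by
  rw [← List.equivSigmaTuple.symm.tsum_eq, ENNReal.tsum_sigma', ← ENNReal.tsum_geometric]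
  refine tsum_congr fun k => ?_
  rw [tsum_fintype, Fintype.sum_pow]
  refine Finset.sum_congr rfl fun p _ => ?_
  simp [List.equivSigmaTuple, List.map_ofFn, List.prod_ofFn]

theorem eq_zero_of_eventually_hasSum_pow {q : ℕ → ℂ}
    (h : ∀ᶠ t : ℂ in 𝓝 0, HasSum (fun m => t ^ m * q m) 0) (m : ℕ) : q m = 0 := by
  have h1 : HasFPowerSeriesAt (0 : ℂ → ℂ) (FormalMultilinearSeries.ofScalars ℂ q) 0 := by
    rw [hasFPowerSeriesAt_iff]
    filter_upwards [h] with t ht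
    simpa [FormalMultilinearSeries.coeff_ofScalars] using ht
  rw [← FormalMultilinearSeries.coeff_ofScalars (𝕜 := ℂ) (p := q), h1.eq_zero]
  simp [FormalMultilinearSeries.coeff]

theorem eq_zero_of_sum_evalMulti {n : ℕ} {s : Finset (Fin n → ℕ)} {c : (Fin n → ℕ) → ℂ}
    (h : ∀ l : Fin n → ℂ, ∑ k ∈ s, c k * evalMulti l k = 0) {k : Fin n → ℕ} (hk : k ∈ s) :
    c k = 0 := by
  classical
  have h1 : (∑ k ∈ s, MvPolynomial.monomial (Finsupp.equivFunOnFinite.symm k) (c k)) = 0 := by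
    refine MvPolynomial.funext fun l => ?_
    rw [map_sum, map_zero, ← h l]
    refine Finset.sum_congr rfl fun k _ => ?_
    rw [MvPolynomial.eval_monomial, Finsupp.prod_fintype _ _ fun i => pow_zero _]
    rfl
  have h2 := congrArg (MvPolynomial.coeff (Finsupp.equivFunOnFinite.symm k)) h1
  simpa [MvPolynomial.coeff_sum, MvPolynomial.coeff_monomial, hk] using h2

namespace PositiveRegular

variable {n : ℕ} (f : PositiveRegular n)

/-- The limsup condition bounds all long words by `c ^ |α|`; finitely many short ones are bounded by
`B`. Taking `M ≥ 1` absorbs `B` at every nonempty word, and `a_1 = 0` settles the empty one. -/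
theorem exists_a_le_pow : ∃ M : ℝ, 0 ≤ M ∧ ∀ α, f.a α ≤ M ^ α.length := by
  obtain ⟨c, hc, -⟩ := ENNReal.lt_iff_exists_nnreal_btwn.1 f.limsup_lt_top
  obtain ⟨N, hN⟩ := Filter.eventually_atTop.1 (Filter.eventually_lt_of_limsup_lt hc)
  obtain ⟨B, hB⟩ := ((List.finite_length_le (Fin n) N).image f.a).bddAbove
  refine ⟨max 1 (max (c : ℝ) B), by positivity, fun α => ?_⟩
  rcases eq_or_ne α 1 with rfl | hα
  · simp [f.a_one]
  have hpos : α.length ≠ 0 := fun h => hα (FreeMonoid.length_eq_zero.1 h)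
  rcases le_total α.length N with hle | hle
  · calc f.a α ≤ B := hB ⟨α, hle, rfl⟩
      _ ≤ max 1 (max (c : ℝ) B) := (le_max_right _ _).trans (le_max_right _ _)
      _ ≤ _ := le_self_pow₀ (le_max_left _ _) hpos
  · have h1 : ‖f.a α‖ₑ ^ 2 ≤ ((c : ℝ≥0∞) ^ α.length) ^ 2 := by
      have h2 := pow_le_pow_left' (hN _ hle).le (2 * α.length)
      rw [← ENNReal.rpow_natCast, ← ENNReal.rpow_mul] at h2
      have h3 : (1 / (2 * (α.length : ℝ))) * ((2 * α.length : ℕ) : ℝ) = 1 := by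
        push_cast; field_simp
      rw [h3, ENNReal.rpow_one, mul_comm, pow_mul] at h2
      exact (ENNReal.le_tsum (f := fun β : {β : FreeMonoid (Fin n) // β.length = α.length} =>
        ‖f.a β‖ₑ ^ 2) ⟨α, rfl⟩).trans h2
    have h2 := (ENNReal.pow_le_pow_left_iff two_ne_zero).1 h1
    rw [← ENNReal.coe_pow, enorm_le_coe, ← NNReal.coe_le_coe] at h2
    rw [coe_nnnorm, Real.norm_of_nonneg (f.a_nonneg α), NNReal.coe_pow] at h2
    refine h2.trans (pow_le_pow_left₀ c.2 ((le_max_left _ _).trans (le_max_right _ _)) _)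

theorem domain_mem_nhds : f.domain ∈ 𝓝 0 := by
  classical
  obtain ⟨M, hM, hMa⟩ := f.exists_a_le_pow
  have hcont : Continuous fun l : Fin n → ℂ => ∑ i, ENNReal.ofReal (M * ‖l i‖ ^ 2) := by
    refine continuous_finsetSum _ fun i _ => ENNReal.continuous_ofReal.comp ?_
    fun_prop
  have hev : ∀ᶠ l in 𝓝 (0 : Fin n → ℂ), ∑ i, ENNReal.ofReal (M * ‖l i‖ ^ 2) < 2⁻¹ :=
    hcont.continuousAt.eventually_lt_const (by simp)
  filter_upwards [hev] with l hl
  -- The list sum below is less than `2` and includes `1` from the empty word, where `a_1 = 0`.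
  -- Keeping that `1` on the left allows it to be cancelled, leaving a sum below `1`.
  have hle : ∀ α : FreeMonoid (Fin n), ENNReal.ofReal (f.a α * ‖evalWord l α‖ ^ 2) +
      (if α = 1 then 1 else 0) ≤
        (α.toList.map fun i => ENNReal.ofReal (M * ‖l i‖ ^ 2)).prod := by
    intro α
    have hprod : ∀ L : List (Fin n), (L.map fun i => ENNReal.ofReal (M * ‖l i‖ ^ 2)).prod =
        ENNReal.ofReal (M ^ L.length * ‖(L.map l).prod‖ ^ 2) := by
      intro L
      induction L with
      | nil => simp
      | cons i L ih =>
        rw [List.map_cons, List.prod_cons, ih, ← ENNReal.ofReal_mul (by positivity)]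
        simp only [List.length_cons, List.map_cons, List.prod_cons, norm_mul]
        congr 1; ring
    rw [hprod]
    split_ifs with h
    · subst h; simp [f.a_one]
    · rw [add_zero]
      refine ENNReal.ofReal_le_ofReal ?_
      rw [evalWord, FreeMonoid.lift_apply]
      exact mul_le_mul_of_nonneg_right (hMa α) (sq_nonneg _)
  have hsum := ENNReal.tsum_le_tsum hle
  rw [ENNReal.tsum_add, tsum_ite_eq] at hsum
  have hlist : ∑' α : FreeMonoid (Fin n),
      (α.toList.map fun i => ENNReal.ofReal (M * ‖l i‖ ^ 2)).prod < 2 := by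
    refine (FreeMonoid.toList.tsum_eq
      (fun L => (L.map fun i => ENNReal.ofReal (M * ‖l i‖ ^ 2)).prod)).trans_lt ?_
    rw [ENNReal.tsum_list_prod, ENNReal.inv_lt_iff_inv_lt]
    refine lt_tsub_iff_right.2 ?_
    calc 2⁻¹ + _ < 2⁻¹ + (2⁻¹ : ℝ≥0∞) := ENNReal.add_lt_add_left (by simp) hl
      _ = 1 := ENNReal.inv_two_add_inv_two
  have hlt : ∑' α, ENNReal.ofReal (f.a α * ‖evalWord l α‖ ^ 2) < 1 := by
    exact lt_of_add_lt_add_right ((hsum.trans_lt hlist).trans_eq one_add_one_eq_two.symm)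
  have hnn : ∀ α, 0 ≤ f.a α * ‖evalWord l α‖ ^ 2 :=
    fun α => mul_nonneg (f.a_nonneg α) (sq_nonneg _)
  have hs : Summable fun α => f.a α * ‖evalWord l α‖ ^ 2 :=
    (ENNReal.summable_toReal (hlt.trans ENNReal.one_lt_top).ne).congr fun α =>
      ENNReal.toReal_ofReal (hnn α)
  refine ⟨hs, ?_⟩
  rwa [← ENNReal.ofReal_tsum_of_nonneg hnn hs, ENNReal.ofReal_lt_one] at hlt

/-- Along each line `t ↦ t l` the series is a one-variable power series vanishing near `0`, its
coefficients being the homogeneous parts evaluated at `l`. These parts are then polynomials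
vanishing on all of `ℂⁿ`. -/
theorem coeff_eq_zero_of_isPowerSeries {c : (Fin n → ℕ) → ℂ} (h : f.IsPowerSeries 0 c) :
    c = 0 := by
  classical
  have hp : ∀ (l : Fin n → ℂ) (m : ℕ),
      ∑ k ∈ Finset.piAntidiag Finset.univ m, c k * evalMulti l k = 0 := by
    intro l
    refine eq_zero_of_eventually_hasSum_pow ?_
    have ht : Filter.Tendsto (fun t : ℂ => t • l) (𝓝 0) (𝓝 0) := by
      have : Continuous fun t : ℂ => t • l := by fun_prop
      simpa using this.tendsto 0
    filter_upwards [ht f.domain_mem_nhds] with t htl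
    have h1 := (h ⟨t • l, htl⟩).tsum_fiberwise fun k : Fin n → ℕ => ∑ i, k i
    refine h1.congr_fun fun m => ?_
    have hset : ((fun k : Fin n → ℕ => ∑ i, k i) ⁻¹' {m} : Set (Fin n → ℕ)) =
        ↑(Finset.piAntidiag (Finset.univ : Finset (Fin n)) m) := by
      ext k; simp
    rw [hset, Finset.tsum_subtype' _ (fun k => c k * evalMulti (t • l) k), Finset.mul_sum]
    refine Finset.sum_congr rfl fun k hk => ?_
    rw [← (Finset.mem_piAntidiag.1 hk).1, ← Finset.prod_pow_eq_pow_sum]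
    simp only [evalMulti, Pi.smul_apply, smul_eq_mul, mul_pow, Finset.prod_mul_distrib]
    ring
  funext k
  exact eq_zero_of_sum_evalMulti (fun l => hp l (∑ i, k i)) (by simp)

theorem IsPowerSeries.unique {f : PositiveRegular n} {φ : f.domain → ℂ} {c d : (Fin n → ℕ) → ℂ}
    (hc : f.IsPowerSeries φ c) (hd : f.IsPowerSeries φ d) : c = d := by
  refine sub_eq_zero.1 (f.coeff_eq_zero_of_isPowerSeries fun l => ?_)
  simpa [sub_mul] using (hc l).sub (hd l)

/-! ### Density of the vectors `z_λ`. -/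

theorem z_mem_symFock (l : f.domain) : f.z l ∈ f.symFock := by
  refine f.mem_symFock_iff.2 fun α β h => ?_
  change (√(f.b β) : ℂ) * (√(f.b α) * conj (evalWord l.1 α)) =
    √(f.b α) * (√(f.b β) * conj (evalWord l.1 β))
  rw [evalWord_eq_evalMulti, evalWord_eq_evalMulti, h]
  ring

theorem eq_zero_of_inner_z_eq_zero {φ : Fock n} (hφ : φ ∈ f.symFock)
    (h : ∀ l, inner ℂ (f.z l) φ = 0) : φ = 0 := by
  obtain ⟨c, hc⟩ := (f.isSymmetric_of_mem hφ).hasSum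
  have : c = 0 := f.coeff_eq_zero_of_isPowerSeries fun l => by
    simpa [h] using f.hasSum_inner_z hc l
  subst this
  exact hc.unique (by simp)

theorem symFock_eq_closure_span_z :
    f.symFock = (Submodule.span ℂ (Set.range f.z)).topologicalClosure := by
  have hle : (Submodule.span ℂ (Set.range f.z)).topologicalClosure ≤ f.symFock := by
    refine Submodule.topologicalClosure_minimal _ ?_ (Submodule.isClosed_topologicalClosure _)
    rw [Submodule.span_le]
    rintro _ ⟨l, rfl⟩
    exact f.z_mem_symFock l
  refine le_antisymm (fun φ hφ => ?_) hle
  -- The component orthogonal to all `z_λ` is still symmetric, and its power series vanishes on the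
  -- domain.
  obtain ⟨y, hy, x, hx, rfl⟩ := Submodule.exists_add_mem_mem_orthogonal
    (K := (Submodule.span ℂ (Set.range f.z)).topologicalClosure) φ
  have hx' : x ∈ f.symFock := by simpa using Submodule.sub_mem _ hφ (hle hy)
  rw [f.eq_zero_of_inner_z_eq_zero hx' fun l => hx _ (Submodule.le_topologicalClosure _
    (Submodule.subset_span (Set.mem_range_self l))), add_zero]
  exact hy

end PositiveRegular

/-! ### Matrix coefficients in the w*-topology. -/

theorem continuous_weakStarTopology_inner {H : Type*} [NormedAddCommGroup H]
    [InnerProductSpace ℂ H] (x y : H) :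
    Continuous[weakStarTopology H, inferInstance] fun T : H →L[ℂ] H => inner ℂ y (T x) := by
  -- A single vector is viewed as a square-summable sequence supported at `0`.
  have hs : ∀ v : H, Summable fun k : ℕ => ‖if k = 0 then v else 0‖ ^ 2 := fun v =>
    summable_of_ne_finset_zero (s := {0}) fun k hk => by
      rw [if_neg (by simpa using hk)]; simp
  have h : (fun T : H →L[ℂ] H => inner ℂ y (T x)) = fun T : H →L[ℂ] H =>
      ∑' k : ℕ, inner ℂ (if k = 0 then y else 0) (T (if k = 0 then x else 0)) := by
    funext T
    rw [tsum_eq_single 0 fun k hk => by simp [hk]]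
    simp
  rw [h]
  exact continuous_iInf_dom (i := fun k => if k = 0 then x else 0)
    (continuous_iInf_dom (i := fun k => if k = 0 then y else 0)
      (continuous_iInf_dom (i := hs x) (continuous_iInf_dom (i := hs y) continuous_induced_dom)))

theorem isClosed_weakStarTopology_inner_eq {H : Type*} [NormedAddCommGroup H]
    [InnerProductSpace ℂ H] (x y x' y' : H) :
    IsClosed[weakStarTopology H] {T : H →L[ℂ] H | inner ℂ y (T x) = inner ℂ y' (T x')} :=
  @isClosed_eq _ _ _ (weakStarTopology H) _ _ _ (continuous_weakStarTopology_inner x y)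
    (continuous_weakStarTopology_inner x' y')

namespace PositiveRegular

variable {n : ℕ} (f : PositiveRegular n)

/-! ### The Hardy algebra as the commutant of the right creation operators. -/

/-- Appending the one-letter factor `g_i` embeds the factorizations of `α` into those of `α g_i`.
This bounds the right creation operators. -/
theorem b_mul_of_le (i : Fin n) (α : FreeMonoid (Fin n)) :
    f.a (FreeMonoid.of i) * f.b α ≤ f.b (α * FreeMonoid.of i) := by
  classical
  have hinj : Function.Injective fun L : List (FreeMonoid (Fin n)) => L ++ [FreeMonoid.of i] :=
    List.append_left_injective _
  calc f.a (FreeMonoid.of i) * f.b α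
      = ∑ L ∈ (factorizations α).map ⟨_, hinj⟩, (L.map f.a).prod := by
        simp [b, ← Finset.sum_mul, mul_comm]
    _ ≤ f.b (α * FreeMonoid.of i) := by
        refine Finset.sum_le_sum_of_subset_of_nonneg ?_ fun L _ _ => f.prod_nonneg L
        intro L hL
        obtain ⟨M, hM, rfl⟩ := Finset.mem_map.1 hL
        rw [mem_factorizations] at hM ⊢
        refine ⟨by simp [hM.1], fun w hw => ?_⟩
        rcases List.mem_append.1 hw with h | h
        · exact hM.2 w h
        · rw [List.mem_singleton.1 h]; exact FreeMonoid.of_ne_one i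

/-- The weight `√(b_α / b_β)`. -/
def weight (α β : FreeMonoid (Fin n)) : ℂ := (√(f.b α / f.b β) : ℝ)

theorem weight_mul_sqrt (α β : FreeMonoid (Fin n)) :
    f.weight α β * √(f.b β) = √(f.b α) := by
  rw [weight, ← Complex.ofReal_mul, ← Real.sqrt_mul (div_nonneg (f.b_nonneg _) (f.b_nonneg _)),
    div_mul_cancel₀ _ (f.b_pos β).ne']

theorem weight_ne_zero (α β : FreeMonoid (Fin n)) : f.weight α β ≠ 0 :=
  left_ne_zero_of_mul (f.weight_mul_sqrt α β ▸ f.sqrt_b_ne_zero α)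

theorem weight_mul_weight (α β δ : FreeMonoid (Fin n)) :
    f.weight α β * f.weight β δ = f.weight α δ := by
  apply mul_right_cancel₀ (f.sqrt_b_ne_zero δ)
  rw [mul_assoc, weight_mul_sqrt, weight_mul_sqrt, weight_mul_sqrt]

theorem norm_weight_sq_le (i : Fin n) (α : FreeMonoid (Fin n)) :
    ‖f.weight α (α * FreeMonoid.of i)‖ ^ 2 ≤ (f.a (FreeMonoid.of i))⁻¹ := by
  have hi := f.a_of_pos i
  rw [weight, Complex.norm_real, Real.norm_eq_abs, sq_abs,
    Real.sq_sqrt (div_nonneg (f.b_nonneg _) (f.b_nonneg _)), div_le_iff₀ (f.b_pos _),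
    inv_mul_eq_div, le_div_iff₀ hi, mul_comm]
  exact f.b_mul_of_le i α

theorem hasSum_norm_sq_fock (φ : Fock n) : HasSum (fun α => ‖φ α‖ ^ 2) (‖φ‖ ^ 2) := by
  simpa using lp.hasSum_norm (p := 2) (by norm_num) φ

theorem mul_of_injective (i : Fin n) :
    Function.Injective fun α : FreeMonoid (Fin n) => α * FreeMonoid.of i :=
  fun _ _ h => mul_right_cancel h

theorem norm_backward_sq_le (i : Fin n) (φ : Fock n) (α : FreeMonoid (Fin n)) :
    ‖f.weight α (α * FreeMonoid.of i) * φ (α * FreeMonoid.of i)‖ ^ 2 ≤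
      (f.a (FreeMonoid.of i))⁻¹ * ‖φ (α * FreeMonoid.of i)‖ ^ 2 := by
  rw [norm_mul, mul_pow]
  exact mul_le_mul_of_nonneg_right (f.norm_weight_sq_le i α) (sq_nonneg _)

theorem summable_backward (i : Fin n) (φ : Fock n) :
    Summable fun α => ‖f.weight α (α * FreeMonoid.of i) * φ (α * FreeMonoid.of i)‖ ^ 2 :=
  Summable.of_nonneg_of_le (fun _ => sq_nonneg _) (f.norm_backward_sq_le i φ)
    (((hasSum_norm_sq_fock φ).summable.comp_injective (mul_of_injective i)).mul_left _)

/-- The weighted right annihilation operators, the adjoints of the weighted right creation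
operators. -/
def rightBackward (i : Fin n) : Fock n →L[ℂ] Fock n :=
  LinearMap.mkContinuous
    { toFun := fun φ => ⟨fun α => f.weight α (α * FreeMonoid.of i) * φ (α * FreeMonoid.of i),
        memℓp_gen (by simpa using f.summable_backward i φ)⟩
      map_add' := fun φ ψ => by
        ext α
        exact mul_add _ _ _
      map_smul' := fun c φ => by
        ext α
        exact mul_left_comm _ _ _ }
    (√(f.a (FreeMonoid.of i))⁻¹) fun φ => by
      have hi := f.a_of_pos i
      refine (sq_le_sq₀ (norm_nonneg _) (by positivity)).1 ?_
      rw [mul_pow, Real.sq_sqrt (inv_nonneg.2 hi.le), ← (hasSum_norm_sq_fock _).tsum_eq,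
        ← (hasSum_norm_sq_fock φ).tsum_eq, ← tsum_mul_left]
      have hs := (hasSum_norm_sq_fock φ).summable.mul_left (f.a (FreeMonoid.of i))⁻¹
      exact ((f.summable_backward i φ).tsum_le_tsum (f.norm_backward_sq_le i φ)
        (hs.comp_injective (mul_of_injective i))).trans
        (tsum_comp_le_tsum_of_inj hs (fun _ => by positivity) (mul_of_injective i))

/-- The weighted right creation operators. -/
def R (i : Fin n) : Fock n →L[ℂ] Fock n := ContinuousLinearMap.adjoint (f.rightBackward i)

theorem R_e (i : Fin n) (α : FreeMonoid (Fin n)) :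
    f.R i (Fock.e α) = f.weight α (α * FreeMonoid.of i) • Fock.e (α * FreeMonoid.of i) := by
  classical
  ext β
  rw [← Fock.inner_e_left, R, ContinuousLinearMap.adjoint_inner_right, Fock.inner_e_right]
  change conj (f.weight α (α * FreeMonoid.of i) * (Fock.e β : Fock n) (α * FreeMonoid.of i)) =
    f.weight α (α * FreeMonoid.of i) * (Fock.e (α * FreeMonoid.of i) : Fock n) β
  rw [map_mul, weight, Complex.conj_ofReal, Fock.e_apply, Fock.e_apply]
  simp [eq_comm]

/-- Left and right concatenation commute, and by `weight_mul_weight` the weights telescope to the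
same factor in either order. -/
theorem W_mul_R (i j : Fin n) : f.W j * f.R i = f.R i * f.W j := by
  refine Fock.clm_ext fun α => ?_
  have hW : ∀ β, f.W j (Fock.e β) =
      f.weight β (FreeMonoid.of j * β) • Fock.e (FreeMonoid.of j * β) := f.W_e j
  simp only [mul_apply_eq_comp, R_e, hW, map_smul, smul_smul, weight_mul_weight,
    mul_assoc]

theorem wordW_mul (α β : FreeMonoid (Fin n)) : f.wordW (α * β) = f.wordW α * f.wordW β :=
  map_mul _ _ _

theorem wordW_of (i : Fin n) : f.wordW (FreeMonoid.of i) = f.W i := FreeMonoid.lift_eval_of _ _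

theorem wordW_one : f.wordW 1 = 1 := map_one _

theorem wordW_e (β γ : FreeMonoid (Fin n)) :
    f.wordW β (Fock.e γ) = f.weight γ (β * γ) • Fock.e (β * γ) := by
  induction β using FreeMonoid.inductionOn' with
  | one =>
    have : f.weight γ γ = 1 := by simp [weight, div_self (f.b_pos γ).ne']
    simp [wordW_one, this]
  | of_mul i β ih =>
    rw [wordW_mul, wordW_of, mul_apply_eq_comp, ih, map_smul, W_e]
    change _ • f.weight _ _ • _ = _
    rw [smul_smul, weight_mul_weight, mul_assoc]

theorem wordW_mul_R (i : Fin n) (β : FreeMonoid (Fin n)) :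
    f.wordW β * f.R i = f.R i * f.wordW β := by
  induction β using FreeMonoid.inductionOn' with
  | one => simp [wordW_one]
  | of_mul j β ih => rw [wordW_mul, wordW_of, mul_assoc, ih, ← mul_assoc, W_mul_R, mul_assoc]

theorem e_mem_polynomials (α : FreeMonoid (Fin n)) : Fock.e α ∈ Fock.polynomials n :=
  Submodule.subset_span (Set.mem_range_self α)

theorem mul_R_of_mem_hardy {A : Fock n →L[ℂ] Fock n} (hA : A ∈ f.hardy) (i : Fin n) :
    A * f.R i = f.R i * A := by
  obtain ⟨c, -, hc⟩ := hA
  refine Fock.clm_ext fun γ => ?_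
  have h1 := (hc _ (e_mem_polynomials γ)).mapL (f.R i)
  have h2 := hc (f.R i (Fock.e γ)) (by
    rw [R_e]; exact Submodule.smul_mem _ _ (e_mem_polynomials _))
  refine h2.unique (h1.congr_fun fun β => ?_)
  rw [map_smul, ← mul_apply_eq_comp, wordW_mul_R]
  rfl

/-- The coefficients of `A` are dictated by `A 1`, and commutation with the `R_i` carries the
expansion from `e_1` to every `e_γ`. The commutant description makes closure under products
immediate and w*-closedness checkable on matrix coefficients. -/
theorem mem_hardy_of_mul_R {A : Fock n →L[ℂ] Fock n} (hA : ∀ i, A * f.R i = f.R i * A) :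
    A ∈ f.hardy := by
  set c : FreeMonoid (Fin n) → ℂ := fun β => √(f.b β) * A (Fock.e 1) β
  refine ⟨c, (hasSum_norm_sq_fock (A (Fock.e 1))).summable.congr fun β => ?_, fun p hp => ?_⟩
  · simp only [c]
    rw [norm_mul, mul_pow, Complex.norm_real, Real.norm_eq_abs, sq_abs,
      Real.sq_sqrt (f.b_nonneg β), mul_div_cancel_left₀ _ (f.b_pos β).ne']
  have he : ∀ γ : FreeMonoid (Fin n),
      HasSum (fun β => c β • f.wordW β (Fock.e γ)) (A (Fock.e γ)) := by
    suffices h : ∀ L : List (Fin n), HasSum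
        (fun β => c β • f.wordW β (Fock.e (FreeMonoid.ofList L))) (A (Fock.e (FreeMonoid.ofList L)))
      from fun γ => h γ.toList
    intro L
    -- Letters are added on the right because `R_i` appends there.
    induction L using List.reverseRecOn with
    | nil =>
      refine (Fock.hasSum_e (A (Fock.e 1))).congr_fun fun β => ?_
      change c β • f.wordW β (Fock.e 1) = _
      have hw := f.weight_mul_sqrt 1 β
      rw [wordW_e, smul_smul, mul_one]
      congr 1
      simp only [c]
      rw [b_one, Real.sqrt_one, Complex.ofReal_one] at hw
      linear_combination (A (Fock.e 1) β) * hw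
    | append_singleton L i ih =>
      rw [FreeMonoid.ofList_append, FreeMonoid.ofList_singleton]
      set γ := FreeMonoid.ofList L
      have h1 := (ih.mapL (f.R i)).const_smul (f.weight γ (γ * FreeMonoid.of i))⁻¹
      have h2 : ∀ T : Fock n →L[ℂ] Fock n, T * f.R i = f.R i * T →
          (f.weight γ (γ * FreeMonoid.of i))⁻¹ • f.R i (T (Fock.e γ)) =
            T (Fock.e (γ * FreeMonoid.of i)) := fun T hT => by
        rw [← mul_apply_eq_comp, ← hT, mul_apply_eq_comp, R_e, map_smul,
          inv_smul_smul₀ (f.weight_ne_zero _ _)]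
      rw [h2 A (hA i)] at h1
      refine h1.congr_fun fun β => ?_
      rw [map_smul, smul_comm, h2 _ (f.wordW_mul_R i β)]
  induction hp using Submodule.span_induction with
  | mem x hx => obtain ⟨γ, rfl⟩ := hx; exact he γ
  | zero => simp
  | add x y _ _ hx hy => simpa using hx.add hy
  | smul r x _ hx => simpa [smul_comm r] using hx.const_smul r

theorem mem_hardy_iff {A : Fock n →L[ℂ] Fock n} :
    A ∈ f.hardy ↔ ∀ i, A * f.R i = f.R i * A :=
  ⟨fun h => f.mul_R_of_mem_hardy h, f.mem_hardy_of_mul_R⟩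

/-! ### Point evaluations and the ideal of vanishing symbols. -/

theorem inner_z_e (l : f.domain) (α : FreeMonoid (Fin n)) :
    inner ℂ (f.z l) (Fock.e α) = √(f.b α) * evalWord l.1 α := by
  rw [Fock.inner_e_right]
  change conj ((√(f.b α) : ℂ) * conj (evalWord l.1 α)) = _
  simp

theorem inner_z_wordW_e (l : f.domain) (β γ : FreeMonoid (Fin n)) :
    inner ℂ (f.z l) (f.wordW β (Fock.e γ)) = evalWord l.1 β * inner ℂ (f.z l) (Fock.e γ) := by
  rw [wordW_e, inner_smul_right, inner_z_e, inner_z_e, ← mul_assoc, weight_mul_sqrt, evalWord,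
    map_mul, evalWord, evalWord]
  ring

/-- The vectors `z_λ` are eigenvectors of the adjoints of the elements of the Hardy algebra. -/
theorem inner_z_hardy {A : Fock n →L[ℂ] Fock n} (hA : A ∈ f.hardy) (l : f.domain) (φ : Fock n) :
    inner ℂ (f.z l) (A φ) = inner ℂ (f.z l) (A (Fock.e 1)) * inner ℂ (f.z l) φ := by
  obtain ⟨c, -, hc⟩ := hA
  have h : ∀ γ, HasSum (fun β => c β * evalWord l.1 β * inner ℂ (f.z l) (Fock.e γ))
      (inner ℂ (f.z l) (A (Fock.e γ))) := fun γ =>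
    ((hc _ (e_mem_polynomials γ)).mapL (innerSL ℂ (f.z l))).congr_fun fun β => by
      rw [innerSL_apply_apply, inner_smul_right, inner_z_wordW_e, mul_assoc]
  have h1 : inner ℂ (f.z l) (Fock.e 1) = 1 := by
    rw [inner_z_e]; simp [b_one, evalWord]
  have hEq : innerSL ℂ (f.z l) ∘L A =
      inner ℂ (f.z l) (A (Fock.e 1)) • innerSL ℂ (f.z l) := by
    refine Fock.clm_ext fun γ => ?_
    have h2 := (h 1).mul_right (inner ℂ (f.z l) (Fock.e γ))
    simp only [h1, mul_one] at h2
    exact (h γ).unique h2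
  exact congrArg (fun T => T φ) hEq

/-- The elements of the Hardy algebra whose symbols vanish on the domain. -/
def vanishing : Submodule ℂ (Fock n →L[ℂ] Fock n) where
  carrier := {A | (∀ i, A * f.R i = f.R i * A) ∧ ∀ l, inner ℂ (f.z l) (A (Fock.e 1)) = 0}
  zero_mem' := by simp
  add_mem' := by
    rintro A B ⟨hA, hA'⟩ ⟨hB, hB'⟩
    exact ⟨fun i => by rw [add_mul, mul_add, hA, hB], fun l => by simp [hA', hB']⟩
  smul_mem' := by
    rintro c A ⟨hA, hA'⟩
    exact ⟨fun i => by rw [smul_mul_assoc, mul_smul_comm, hA],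
      fun l => by simp [hA']⟩

theorem mem_vanishing_iff {A : Fock n →L[ℂ] Fock n} :
    A ∈ f.vanishing ↔ A ∈ f.hardy ∧ ∀ l, inner ℂ (f.z l) (A (Fock.e 1)) = 0 := by
  rw [mem_hardy_iff]; rfl

theorem mul_mem_hardy {A B : Fock n →L[ℂ] Fock n} (hA : A ∈ f.hardy) (hB : B ∈ f.hardy) :
    A * B ∈ f.hardy := by
  rw [mem_hardy_iff] at *
  intro i
  rw [mul_assoc, hB, ← mul_assoc, hA, mul_assoc]

theorem isWeakStarClosedIdeal_vanishing : f.IsWeakStarClosedIdeal f.vanishing where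
  subset_hardy B hB := (f.mem_vanishing_iff.1 hB).1
  mul_mem_left A hA B hB := by
    rw [mem_vanishing_iff] at *
    refine ⟨f.mul_mem_hardy hA hB.1, fun l => ?_⟩
    rw [mul_apply_eq_comp, f.inner_z_hardy hA, hB.2, mul_zero]
  mul_mem_right A hA B hB := by
    rw [mem_vanishing_iff] at *
    refine ⟨f.mul_mem_hardy hB.1 hA, fun l => ?_⟩
    rw [mul_apply_eq_comp, f.inner_z_hardy hB.1, hB.2, zero_mul]
  isClosed := by
    -- For w*-closedness each condition becomes an equality of two matrix coefficients of `T`: the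
    -- outer `R_i` moves to `e_δ` as its adjoint, and `T 0` paired with `0` stands for zero.
    have hset : (f.vanishing : Set (Fock n →L[ℂ] Fock n)) =
        (⋂ (i) (γ) (δ), {T : Fock n →L[ℂ] Fock n | inner ℂ (Fock.e δ) (T (f.R i (Fock.e γ))) =
          inner ℂ (f.rightBackward i (Fock.e δ)) (T (Fock.e γ))}) ∩
        ⋂ l, {T : Fock n →L[ℂ] Fock n | inner ℂ (f.z l) (T (Fock.e 1)) =
          inner ℂ (0 : Fock n) (T 0)} := by
      ext A
      simp only [Set.mem_inter_iff, Set.mem_iInter, Set.mem_ofPred_eq, inner_zero_left]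
      refine and_congr (forall_congr' fun i => ?_) Iff.rfl
      have hR : ∀ γ δ, inner ℂ (f.rightBackward i (Fock.e δ)) (A (Fock.e γ)) =
          inner ℂ (Fock.e δ) (f.R i (A (Fock.e γ))) := fun γ δ =>
        (ContinuousLinearMap.adjoint_inner_right _ _ _).symm
      simp only [hR, Fock.inner_e_left]
      refine ⟨fun h γ δ => ?_, fun h => Fock.clm_ext fun γ => ?_⟩
      · rw [← mul_apply_eq_comp, h]; rfl
      · ext δ; exact h γ δ
    rw [hset]
    refine @IsClosed.inter _ _ _ (weakStarTopology (Fock n)) ?_ ?_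
    · exact @isClosed_iInter _ _ (weakStarTopology (Fock n)) _ fun i =>
        @isClosed_iInter _ _ (weakStarTopology (Fock n)) _ fun γ =>
        @isClosed_iInter _ _ (weakStarTopology (Fock n)) _ fun δ =>
        isClosed_weakStarTopology_inner_eq _ _ _ _
    · exact @isClosed_iInter _ _ (weakStarTopology (Fock n)) _ fun l =>
        isClosed_weakStarTopology_inner_eq _ _ _ _

theorem wordW_mem_hardy (β : FreeMonoid (Fin n)) : f.wordW β ∈ f.hardy :=
  f.mem_hardy_iff.2 fun i => f.wordW_mul_R i β

theorem W_mul_W (i j : Fin n) :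
    f.W i * f.W j = f.wordW (FreeMonoid.of i * FreeMonoid.of j) := by
  rw [wordW_mul, wordW_of, wordW_of]

theorem commutator_mem_vanishing (i j : Fin n) :
    f.W i * f.W j - f.W j * f.W i ∈ f.vanishing := by
  rw [W_mul_W, W_mul_W, mem_vanishing_iff, mem_hardy_iff]
  refine ⟨fun k => by rw [sub_mul, mul_sub, wordW_mul_R, wordW_mul_R], fun l => ?_⟩
  rw [sub_apply, inner_sub_right, inner_z_wordW_e, inner_z_wordW_e]
  simp [evalWord, mul_comm]

theorem commIdeal_le_vanishing : f.commIdeal ≤ f.vanishing :=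
  sInf_le ⟨f.isWeakStarClosedIdeal_vanishing, f.commutator_mem_vanishing⟩

/-! ### The commutator ideal and its orthogonal complement. -/

theorem mul_commutator_mul_mem (p s : FreeMonoid (Fin n)) (i j : Fin n) :
    f.wordW p * (f.W i * f.W j - f.W j * f.W i) * f.wordW s ∈ f.commIdeal := by
  refine (Submodule.mem_sInf).2 fun J hJ => ?_
  exact hJ.1.mul_mem_right _ (f.wordW_mem_hardy s) _
    (hJ.1.mul_mem_left _ (f.wordW_mem_hardy p) _ (hJ.2 i j))

theorem mem_commN_iff {φ : Fock n} :
    φ ∈ f.commN ↔ ∀ A ∈ f.commIdeal, inner ℂ (A (Fock.e 1)) φ = 0 := by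
  rw [commN, Submodule.orthogonal_closure, Submodule.mem_orthogonal]
  simp

/-- Applied to `e_1`, the element `W_p (W_i W_j - W_j W_i) W_s` gives a difference of two weighted
basis vectors whose words differ by one adjacent swap. -/
theorem weight_mul_eq_of_mem_commN {φ : Fock n} (hφ : φ ∈ f.commN) (p s : FreeMonoid (Fin n))
    (i j : Fin n) :
    f.weight 1 (p * (FreeMonoid.of i * (FreeMonoid.of j * s))) *
        φ (p * (FreeMonoid.of i * (FreeMonoid.of j * s))) =
      f.weight 1 (p * (FreeMonoid.of j * (FreeMonoid.of i * s))) *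
        φ (p * (FreeMonoid.of j * (FreeMonoid.of i * s))) := by
  have h := f.mem_commN_iff.1 hφ _ (f.mul_commutator_mul_mem p s i j)
  have hconj : ∀ α β, conj (f.weight α β) = f.weight α β := fun α β => Complex.conj_ofReal _
  rw [W_mul_W, W_mul_W, mul_sub, sub_mul, ← wordW_mul, ← wordW_mul, ← wordW_mul, ← wordW_mul,
    sub_apply, wordW_e, wordW_e, inner_sub_left, inner_smul_left,
    inner_smul_left, Fock.inner_e_left, Fock.inner_e_left, hconj, hconj, sub_eq_zero] at h
  simpa only [mul_assoc, mul_one] using h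

theorem weight_mul_eq_of_perm {φ : Fock n} (hφ : φ ∈ f.commN) {α β : List (Fin n)}
    (h : α.Perm β) (p : FreeMonoid (Fin n)) :
    f.weight 1 (p * FreeMonoid.ofList α) * φ (p * FreeMonoid.ofList α) =
      f.weight 1 (p * FreeMonoid.ofList β) * φ (p * FreeMonoid.ofList β) := by
  -- The prefix `p` absorbs the common first letter in the `cons` case, so adjacent swaps at any
  -- position are reached.
  induction h generalizing p with
  | nil => rfl
  | cons x _ ih => simpa only [FreeMonoid.ofList_cons, mul_assoc] using ih (p * FreeMonoid.of x)
  | swap x y l =>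
    simpa only [FreeMonoid.ofList_cons] using
      f.weight_mul_eq_of_mem_commN hφ p (FreeMonoid.ofList l) y x
  | trans _ _ ih₁ ih₂ => exact (ih₁ p).trans (ih₂ p)

theorem symFock_eq_commN : f.symFock = f.commN := by
  refine le_antisymm ?_ fun φ hφ => f.mem_symFock_iff.2 fun α β h => ?_
  · rw [symFock_eq_closure_span_z]
    refine Submodule.topologicalClosure_minimal _ ?_ (Submodule.isClosed_orthogonal _)
    rw [Submodule.span_le]
    rintro _ ⟨l, rfl⟩
    refine f.mem_commN_iff.2 fun A hA => ?_
    rw [← inner_conj_symm, (f.mem_vanishing_iff.1 (f.commIdeal_le_vanishing hA)).2 l, map_zero]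
  · have hp : α.toList.Perm β.toList := List.perm_iff_count.2 fun i => congrFun h i
    have h1 := f.weight_mul_eq_of_perm hφ hp 1
    simp only [one_mul, FreeMonoid.ofList_toList] at h1
    have ha := f.weight_mul_sqrt 1 α
    have hb := f.weight_mul_sqrt 1 β
    rw [b_one, Real.sqrt_one, Complex.ofReal_one] at ha hb
    linear_combination √(f.b α) * √(f.b β) * h1 - √(f.b β) * φ α * ha + √(f.b α) * φ β * hb

/-! ### The Hilbert space `H²`. -/

theorem inner_z_mem_H2Submodule {φ : Fock n} (hφ : φ ∈ f.symFock) :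
    (fun l => inner ℂ (f.z l) φ) ∈ f.H2Submodule := by
  obtain ⟨c, hc⟩ := (f.isSymmetric_of_mem hφ).hasSum
  exact ⟨c, f.hasSum_inner_z hc, (f.hasSum_norm_sq hc).summable⟩

/-- The functional representation `φ ↦ (λ ↦ ⟨φ, z_λ⟩)` of the symmetric Fock space. -/
def toH2Linear : f.symFock →ₗ[ℂ] f.H2 where
  toFun φ := (⟨_, f.inner_z_mem_H2Submodule φ.2⟩ : f.H2Submodule)
  map_add' _ _ := Subtype.ext (funext fun _ => inner_add_right _ _ _)
  map_smul' _ _ := Subtype.ext (funext fun _ => inner_smul_right _ _ _)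

/-- Injectivity is the density of the `z_λ`; for surjectivity, the coefficients of a given function
are summed against the `w^k`. -/
theorem toH2Linear_bijective : Function.Bijective f.toH2Linear := by
  constructor
  · rw [← LinearMap.ker_eq_bot, LinearMap.ker_eq_bot']
    intro φ hφ
    exact Subtype.ext (f.eq_zero_of_inner_z_eq_zero φ.2 fun l =>
      congrFun (congrArg Subtype.val hφ) l)
  · rintro ⟨φ, c, hc, hs⟩
    obtain ⟨ψ, hψ⟩ := f.exists_hasSum_w hs
    exact ⟨⟨ψ, f.mem_symFock_of_hasSum hψ⟩, Subtype.ext (funext fun l =>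
      (f.hasSum_inner_z hψ l).unique (hc l))⟩

/-- The functional representation as a linear equivalence. -/
def toH2 : f.symFock ≃ₗ[ℂ] f.H2 := LinearEquiv.ofBijective f.toH2Linear f.toH2Linear_bijective

/-- The inner product of `H²`, transported from the symmetric Fock space. -/
abbrev H2Core : InnerProductSpace.Core ℂ f.H2 where
  inner φ ψ := inner ℂ (f.toH2.symm φ : Fock n) (f.toH2.symm ψ : Fock n)
  conj_inner_symm φ ψ := inner_conj_symm _ _
  re_inner_nonneg φ := inner_self_nonneg
  add_left φ ψ χ := by rw [map_add, Submodule.coe_add, inner_add_left]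
  smul_left φ ψ c := by rw [map_smul, Submodule.coe_smul, inner_smul_left]
  definite φ h := f.toH2.symm.map_eq_zero_iff.1 (Subtype.ext (inner_self_eq_zero.1 h))

end PositiveRegular

end

/-! ### Assembly of the main theorem. -/

theorem mainTheorem11 (n : ℕ) (hn : 1 ≤ n) (f : PositiveRegular n) :
    -- the closed span of the `z_λ`, and the commutator ideal
    (f.symFock = (Submodule.span ℂ (Set.range f.z)).topologicalClosure ∧
      f.symFock = f.commN) ∧
    -- elements of the symmetric Fock space and their functional representation
    (∀ φ ∈ f.symFock,
      (∃! c : (Fin n → ℕ) → ℂ, HasSum (fun k => c k • f.w k) φ) ∧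
      (∀ c : (Fin n → ℕ) → ℂ, HasSum (fun k => c k • f.w k) φ →
        HasSum (fun k => ‖c k‖ ^ 2 * (1 / f.γ k)) (‖φ‖ ^ 2) ∧
        ∀ l : f.domain, HasSum (fun k => c k * evalMulti l.1 k) (inner ℂ (f.z l) φ)) ∧
      (∀ l : f.domain, ‖(inner ℂ (f.z l) φ : ℂ)‖ ≤
        ‖φ‖ / √(1 - ∑' α, f.a α * ‖evalWord l.1 α‖ ^ 2))) ∧
    -- the identification with the Hilbert space `H²`, and its reproducing kernel
    (∃ core : InnerProductSpace.Core ℂ f.H2,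
      letI : NormedAddCommGroup f.H2 := core.toNormedAddCommGroup
      letI : InnerProductSpace ℂ f.H2 := InnerProductSpace.ofCore core.toCore
      (∀ (φ : f.H2) (c : (Fin n → ℕ) → ℂ), f.IsPowerSeries φ.toFun c →
        HasSum (fun k => ‖c k‖ ^ 2 * (1 / f.γ k)) (‖φ‖ ^ 2)) ∧
      (∃ U : f.symFock ≃ₗᵢ[ℂ] f.H2, ∀ (φ : f.symFock) (l : f.domain),
        (U φ).toFun l = inner ℂ (f.z l) (φ : Fock n)) ∧
      ∃ (_ : CompleteSpace f.H2) (R : RKHS ℂ f.H2 f.domain ℂ),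
        (∀ φ : f.H2, R.coeCLM φ = φ.toFun) ∧
        ∀ m l : f.domain, RKHS.kernel f.H2 m l 1 = f.K m l) ∧
    -- the kernel
    ((∀ m l : f.domain,
        (Summable fun α => f.a α * evalWord m.1 α * conj (evalWord l.1 α)) ∧
        1 - ∑' α, f.a α * evalWord m.1 α * conj (evalWord l.1 α) ≠ 0 ∧
        f.K m l = 1 / (1 - ∑' α, f.a α * evalWord m.1 α * conj (evalWord l.1 α))) ∧
      (Matrix.of f.K).PosDef) := by
  refine ⟨⟨f.symFock_eq_closure_span_z, f.symFock_eq_commN⟩, fun φ hφ => ⟨?_, fun c hc =>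
    ⟨f.hasSum_norm_sq hc, f.hasSum_inner_z hc⟩, fun l => f.norm_inner_z_le l φ⟩, ?_,
    fun m l => ⟨f.summable_a_mul m l, f.one_sub_tsum_ne_zero m l, f.K_eq m l⟩, f.posDef_K⟩
  · obtain ⟨c, hc⟩ := (f.isSymmetric_of_mem hφ).hasSum
    exact ⟨c, hc, fun d hd => f.coeff_unique hd hc⟩
  refine ⟨f.H2Core, ?_⟩
  let : NormedAddCommGroup f.H2 := f.H2Core.toNormedAddCommGroup
  let : InnerProductSpace ℂ f.H2 := InnerProductSpace.ofCore f.H2Core.toCore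
  let U : f.symFock ≃ₗᵢ[ℂ] f.H2 := f.toH2.isometryOfInner fun φ ψ => by
    change inner ℂ (f.toH2.symm (f.toH2 φ) : Fock n) (f.toH2.symm (f.toH2 ψ) : Fock n) = _
    rw [LinearEquiv.symm_apply_apply, LinearEquiv.symm_apply_apply]
    rfl
  have hU : ∀ (φ : f.symFock) (l : f.domain), (U φ).toFun l = inner ℂ (f.z l) (φ : Fock n) :=
    fun _ _ => rfl
  have hU' : ∀ (φ : f.H2) (l : f.domain), φ.toFun l = inner ℂ (f.z l) (U.symm φ : Fock n) :=
    fun φ l => by rw [← hU, LinearIsometryEquiv.apply_symm_apply]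
  have hcomplete : CompleteSpace f.symFock :=
    (Submodule.isClosed_topologicalClosure _).completeSpace_coe
  refine ⟨fun φ c hc => ?_, ⟨U, hU⟩, U.toIsometryEquiv.completeSpace_iff.1 hcomplete, ?_⟩
  · obtain ⟨d, hd⟩ := (f.isSymmetric_of_mem (U.symm φ).2).hasSum
    -- Uniqueness of power series coefficients makes the norm independent of the chosen
    -- representation.
    have hcd : c = d := hc.unique fun l => by rw [hU']; exact f.hasSum_inner_z hd l
    subst hcd
    have h := f.hasSum_norm_sq hd
    rwa [← Submodule.coe_norm, LinearIsometryEquiv.norm_map] at h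
  have : CompleteSpace f.H2 := U.toIsometryEquiv.completeSpace_iff.1 hcomplete
  let coe : f.H2 →L[ℂ] f.domain → ℂ := ContinuousLinearMap.pi fun l =>
    innerSL ℂ (f.z l) ∘L f.symFock.subtypeL ∘L (U.symm : f.H2 →L[ℂ] f.symFock)
  have hcoe : ∀ φ, coe φ = φ.toFun := fun φ => funext fun l => (hU' φ l).symm
  let R : RKHS ℂ f.H2 f.domain ℂ :=
    { coeCLM := coe
      coeCLM_injective := fun φ ψ h => Subtype.ext (by
        have h1 : coe φ = coe ψ := h
        rwa [hcoe, hcoe] at h1) }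
  refine ⟨R, hcoe, fun m l => ?_⟩
  -- By Riesz uniqueness the kernel function at `l` is the image of `z_l`: both reproduce the value
  -- at `l`.
  have hker : RKHS.kerFun f.H2 l 1 = U ⟨f.z l, f.z_mem_symFock l⟩ := by
    refine ext_inner_right ℂ fun φ => ?_
    rw [RKHS.kerFun_inner, ← U.apply_symm_apply φ, U.inner_map_map, U.apply_symm_apply]
    have h1 : (φ : f.domain → ℂ) l = inner ℂ (f.z l) (U.symm φ : Fock n) := rfl
    rw [h1]
    simp
  rw [← RKHS.kerFun_apply, hker]
  change coe (U ⟨f.z l, f.z_mem_symFock l⟩) m = f.K m l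
  rw [hcoe]
  rfl
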